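/- Let $\Omega$ be a locally compact, second countable Hausdorff space with Borel $\sigma$-algebra $\mathcal B(\Omega)$, and let $\mathcal H$ be a separable complex Hilbert space with bounded operators $\mathcal L(\mathcal H)$. A *POVM* on a measurable space $S$ (with values in $\mathcal L(\mathcal H)$) is a map $\mathsf E$ from the measurable sets of $S$ to the positive operators in $\mathcal L(\mathcal H)$ with $\mathsf E(S)=I$ that is $\sigma$-additive in the weak operator topology; it is a *PVM* if $\mathsf E(X\cap Y)=\mathsf E(X)\mathsf E(Y)$ for all measurable $X,Y$. For a bounded measurable $\phi:S\to\mathbb C$, $\mathsf E(\phi)=\int_S\phi\,d\mathsf E\in\mathcal L(\mathcal H)$ is the unique operator with $\langle\psi,\mathsf E(\phi)\psi\rangle=\int_S\phi(x)\,\langle\psi,\mathsf E(dx)\psi\rangle$ for all $\psi\in\mathcal H$. If $S$ is a topological space with its Borel $\sigma$-algebra, $\mathsf E'$ denotes the commutant of $\{\mathsf E(f)\mid f\in C_0(S)\}$ in $\mathcal L(\mathcal H)$, where $C_0(S)$ is the space of continuous complex functions on $S$ vanishing at infinity; $\mathsf E$ is *commutative* if $\mathsf E(X)\in\mathsf E'$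 for all Borel sets $X$. Let $B(\Omega)^+$ be the set of positive Borel measures $\mu$ on $\Omega$ with $\mu(\Omega)\le 1$, with the weak*-topology (the coarsest one making $\mu\mapsto\mu(f)=\int_\Omega f\,d\mu$ continuous for every $f\in C_0(\Omega)$) and its Borel $\sigma$-algebra, and let $P(\Omega)=\{\mu\in B(\Omega)^+\mid\mu(\Omega)=1\}$. **Theorem.** Let $\mathsf E$ be a commutative POVM on $\Omega$. Then there exists a unique PVM $\mathsf P$ on $B(\Omega)^+$ such that $$\mathsf E(f)=\int_{B(\Omega)^+}\mu(f)\,d\mathsf P(\mu)\qquad\forall f\in C_0(\Omega),\tag{1}$$ and for a PVM $\mathsf P$ on $B(\Omega)^+$ condition (1) is equivalent to $$\mathsf E(X)=\int_{B(\Omega)^+}\mu(X)\,d\mathsf P(\mu)\qquad\forall X\in\mathcal B(\Omega).\tag{2}$$ Moreover, for this $\mathsf P$, the set $B(\Omega)^+\setminus P(\Omega)$ is a Borel set with $\mathsf P(B(\Omega)^+\setminus P(\Omega))=0$, and $\mathsf E'=\mathsf P'$. -/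

import Mathlib

open MeasureTheory Filter
open scoped Topology ENNReal InnerProductSpace ZeroAtInfty

noncomputable section

/-- A (normalized) positive operator valued measure on a measurable space `α`, with values in the
bounded operators of the Hilbert space `H`. The set function is `σ`-additive in the weak operator
topology. As for `MeasureTheory.VectorMeasure`, it takes the dummy value `0` on the sets that are
not measurable, so that two such measures are equal as soon as they agree on measurable sets. -/
structure POVM (α : Type*) [MeasurableSpace α] (H : Type*) [NormedAddCommGroup H]
    [InnerProductSpace ℂ H] [CompleteSpace H] where
  /-- The operator `E(X)`. -/
  toFun : Set α → H →L[ℂ] H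
  not_measurable' : ∀ X, ¬ MeasurableSet X → toFun X = 0
  isPositive' : ∀ X, MeasurableSet X → (toFun X).IsPositive
  univ' : toFun Set.univ = 1
  empty' : toFun ∅ = 0
  hasSum' : ∀ X : ℕ → Set α, (∀ i, MeasurableSet (X i)) → Pairwise (Function.onFun Disjoint X) →
    ∀ φ ψ : H, HasSum (fun i => ⟪φ, toFun (X i) ψ⟫_ℂ) ⟪φ, toFun (⋃ i, X i) ψ⟫_ℂ

namespace POVM

variable {α : Type*} [MeasurableSpace α] {H : Type*} [NormedAddCommGroup H]
  [InnerProductSpace ℂ H] [CompleteSpace H]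

instance : CoeFun (POVM α H) (fun _ => Set α → H →L[ℂ] H) := ⟨POVM.toFun⟩

theorem isPositive (E : POVM α H) (X : Set α) : (E X).IsPositive := by
  by_cases h : MeasurableSet X
  · exact E.isPositive' X h
  · rw [E.not_measurable' X h]; exact ContinuousLinearMap.isPositive_zero

/-- A projection valued measure (sharp observable): `E(X ∩ Y) = E(X) E(Y)`. -/
def IsSharp (E : POVM α H) : Prop :=
  ∀ X Y : Set α, MeasurableSet X → MeasurableSet Y → E (X ∩ Y) = E X * E Y

/-- The finite positive measure `X ↦ ⟪ψ, E(X) ψ⟫`. For a unit vector `ψ` it is the outcome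
distribution of `E` in the state `ψ`. -/
def scalarMeasure (E : POVM α H) (ψ : H) : Measure α :=
  Measure.ofMeasurable (fun X _ => ENNReal.ofReal (⟪ψ, E X ψ⟫_ℂ).re)
    (by simp [E.empty'])
    (by
      intro X hX hd
      have h := (Complex.hasSum_re (E.hasSum' X hX hd ψ ψ))
      rw [← h.tsum_eq, ENNReal.ofReal_tsum_of_nonneg _ h.summable]
      intro i
      exact (E.isPositive (X i)).re_inner_nonneg_right ψ)

theorem scalarMeasure_apply (E : POVM α H) (ψ : H) {X : Set α} (hX : MeasurableSet X) :
    E.scalarMeasure ψ X = ENNReal.ofReal (⟪ψ, E X ψ⟫_ℂ).re :=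
  Measure.ofMeasurable_apply X hX

theorem scalarMeasure_univ (E : POVM α H) (ψ : H) :
    E.scalarMeasure ψ Set.univ = ENNReal.ofReal (‖ψ‖ ^ 2) := by
  rw [scalarMeasure_apply _ _ MeasurableSet.univ, E.univ']
  congr 1
  exact inner_self_eq_norm_sq (𝕜 := ℂ) ψ

instance (E : POVM α H) (ψ : H) : IsFiniteMeasure (E.scalarMeasure ψ) :=
  ⟨by rw [scalarMeasure_univ]; exact ENNReal.ofReal_lt_top⟩

/-- The bounded operator `A` is the weak integral `∫ f dE`: its expectations in all vector states
are the integrals of `f` against the outcome distributions of `E`. -/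
def IsIntegral (E : POVM α H) (f : α → ℂ) (A : H →L[ℂ] H) : Prop :=
  ∀ ψ : H, Integrable f (E.scalarMeasure ψ) ∧ ⟪ψ, A ψ⟫_ℂ = ∫ x, f x ∂(E.scalarMeasure ψ)

open Classical in
/-- The bounded operator `E(f) = ∫ f dE`. It exists and is characterized by `IsIntegral` for every
bounded measurable `f`, see `isIntegral_integral` and `IsIntegral.unique`. -/
def integral (E : POVM α H) (f : α → ℂ) : H →L[ℂ] H :=
  if h : ∃ A, E.IsIntegral f A then h.choose else 0

theorem IsIntegral.unique {E : POVM α H} {f : α → ℂ} {A B : H →L[ℂ] H}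
    (hA : E.IsIntegral f A) (hB : E.IsIntegral f B) : A = B := by
  have : (A : H →ₗ[ℂ] H) = (B : H →ₗ[ℂ] H) := by
    rw [← ext_inner_map]
    intro ψ
    have := (hA ψ).2.trans (hB ψ).2.symm
    have h2 := congrArg (starRingEnd ℂ) this
    simpa [inner_conj_symm] using h2
  ext x
  exact LinearMap.congr_fun this x

theorem isIntegral_simpleFunc (E : POVM α H) (s : SimpleFunc α ℂ) :
    E.IsIntegral s (∑ c ∈ s.range, c • E (s ⁻¹' {c})) := by
  intro ψ
  have hint : Integrable s (E.scalarMeasure ψ) := SimpleFunc.integrable_of_isFiniteMeasure s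
  refine ⟨hint, ?_⟩
  rw [SimpleFunc.integral_eq_sum s hint, sum_apply, inner_sum]
  refine Finset.sum_congr rfl fun c _ => ?_
  have hpos := E.isPositive (s ⁻¹' {c})
  have hre : ((⟪ψ, E (s ⁻¹' {c}) ψ⟫_ℂ).re : ℂ) = ⟪ψ, E (s ⁻¹' {c}) ψ⟫_ℂ := by
    have h := hpos.inner_nonneg_right ψ
    exact (Complex.eq_re_of_ofReal_le (r := 0) (by simpa using h)).symm
  rw [Measure.real, scalarMeasure_apply _ _ (s.measurableSet_preimage _),
    ENNReal.toReal_ofReal (show 0 ≤ (⟪ψ, E (s ⁻¹' {c}) ψ⟫_ℂ).re from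
      hpos.re_inner_nonneg_right ψ), smul_apply,
    inner_smul_right, Complex.real_smul, hre, mul_comm]

theorem exists_isIntegral (E : POVM α H) {f : α → ℂ} (hf : Measurable f) {C : ℝ}
    (hC : ∀ x, ‖f x‖ ≤ C) : ∃ A, E.IsIntegral f A := by
  rcases isEmpty_or_nonempty α with hα | ⟨⟨x₀⟩⟩
  · refine ⟨0, fun ψ => ⟨?_, ?_⟩⟩
    · simp [Measure.eq_zero_of_isEmpty]
    · simp [Measure.eq_zero_of_isEmpty]
  have hC0 : 0 ≤ C := (norm_nonneg _).trans (hC x₀)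
  have hsm := hf.stronglyMeasurable
  let s : ℕ → SimpleFunc α ℂ := fun n => hsm.approxBounded C n
  let A : ℕ → H →L[ℂ] H := fun n => ∑ c ∈ (s n).range, c • E (s n ⁻¹' {c})
  have hA : ∀ n, E.IsIntegral (s n) (A n) := fun n => E.isIntegral_simpleFunc (s n)
  have hq : ∀ ψ, Tendsto (fun n => ⟪A n ψ, ψ⟫_ℂ) atTop
      (𝓝 (starRingEnd ℂ (∫ x, f x ∂(E.scalarMeasure ψ)))) := by
    intro ψ
    have h : Tendsto (fun n => ∫ x, s n x ∂(E.scalarMeasure ψ)) atTop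
        (𝓝 (∫ x, f x ∂(E.scalarMeasure ψ))) :=
      tendsto_integral_of_dominated_convergence (fun _ => C)
        (fun n => (s n).stronglyMeasurable.aestronglyMeasurable) (integrable_const C)
        (fun n => ae_of_all _ fun x => hsm.norm_approxBounded_le hC0 n x)
        (ae_of_all _ fun x => hsm.tendsto_approxBounded_of_norm_le (hC x))
    have h2 := (Complex.continuous_conj.tendsto _).comp h
    refine h2.congr fun n => ?_
    simp only [Function.comp_apply]
    rw [← (hA n ψ).2, inner_conj_symm]
  have hlim : ∀ x y, ∃ b, Tendsto (fun n => ⟪A n y, x⟫_ℂ) atTop (𝓝 b) := by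
    intro x y
    refine ⟨_, Tendsto.congr (fun n => (inner_map_polarization (A n : H →ₗ[ℂ] H) x y).symm)
      (((((hq (x + y)).sub (hq (x - y))).add ((hq (x + Complex.I • y)).const_mul Complex.I)).sub
        ((hq (x - Complex.I • y)).const_mul Complex.I)).div_const 4)⟩
  choose b hb using hlim
  obtain ⟨K, hK⟩ : ∃ K, ∀ n, ‖A n‖ ≤ K := by
    apply banach_steinhaus
    intro y
    obtain ⟨K, hK⟩ : ∃ K, ∀ n, ‖InnerProductSpace.toDual ℂ H (A n y)‖ ≤ K := by
      apply banach_steinhaus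
      intro x
      obtain ⟨K, hK⟩ := (Metric.isBounded_range_of_tendsto _ (hb x y)).exists_norm_le
      exact ⟨K, fun n => by simpa using hK _ (Set.mem_range_self n)⟩
    exact ⟨K, fun n => by simpa using hK n⟩
  let B : H →ₗ⋆[ℂ] H →ₗ[ℂ] ℂ := LinearMap.mk₂'ₛₗ (starRingEnd ℂ) (RingHom.id ℂ) (fun y x => b x y)
    (fun y y' x => tendsto_nhds_unique (hb _ _)
      (((hb x y).add (hb x y')).congr fun n => by rw [map_add, inner_add_left]))
    (fun c y x => tendsto_nhds_unique (hb _ _)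
      (((hb x y).const_mul _).congr fun n => by rw [map_smul, inner_smul_left]))
    (fun y x x' => tendsto_nhds_unique (hb _ _)
      (((hb x y).add (hb x' y)).congr fun n => by rw [inner_add_right]))
    (fun c y x => tendsto_nhds_unique (hb _ _)
      (((hb x y).const_mul _).congr fun n => by rw [inner_smul_right]; rfl))
  have hBb : ∀ y x, ‖B y x‖ ≤ K * ‖y‖ * ‖x‖ := by
    intro y x
    refine le_of_tendsto (hb x y).norm (Eventually.of_forall fun n => ?_)
    calc ‖⟪A n y, x⟫_ℂ‖ ≤ ‖A n y‖ * ‖x‖ := norm_inner_le_norm _ _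
      _ ≤ K * ‖y‖ * ‖x‖ := by
        gcongr
        exact (A n).le_of_opNorm_le (hK n) y
  refine ⟨InnerProductSpace.continuousLinearMapOfBilin (B.mkContinuous₂ K hBb), fun ψ => ⟨?_, ?_⟩⟩
  · exact Integrable.of_bound hsm.aestronglyMeasurable C (ae_of_all _ hC)
  · rw [← inner_conj_symm, InnerProductSpace.continuousLinearMapOfBilin_apply,
      LinearMap.mkContinuous₂_apply]
    have : B ψ ψ = starRingEnd ℂ (∫ x, f x ∂(E.scalarMeasure ψ)) :=
      tendsto_nhds_unique (hb ψ ψ) (hq ψ)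
    rw [this, Complex.conj_conj]

/-- Every bounded measurable function has an integral. -/
theorem isIntegral_integral (E : POVM α H) {f : α → ℂ} (hf : Measurable f) {C : ℝ}
    (hC : ∀ x, ‖f x‖ ≤ C) : E.IsIntegral f (E.integral f) := by
  have h := E.exists_isIntegral hf hC
  rw [integral, dif_pos h]
  exact h.choose_spec

/-- The commutant `E′` of `{E(f) | f ∈ C₀(Ω)}` in the bounded operators. -/
def commutant [TopologicalSpace α] (E : POVM α H) : Set (H →L[ℂ] H) :=
  Set.centralizer (Set.range fun f : C₀(α, ℂ) => E.integral f)

/-- `E` is commutative if `E(X) ∈ E′` for all Borel sets `X`. -/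
def IsCommutative [TopologicalSpace α] (E : POVM α H) : Prop :=
  ∀ X : Set α, MeasurableSet X → E X ∈ E.commutant

end POVM

/-- The set `B(Ω)⁺` of positive measures on `Ω` of total mass at most one. -/
structure SubprobabilityMeasure (Ω : Type*) [MeasurableSpace Ω] where
  /-- The underlying measure. -/
  toMeasure : Measure Ω
  measure_univ_le_one : toMeasure Set.univ ≤ 1

namespace SubprobabilityMeasure

variable {Ω : Type*} [MeasurableSpace Ω]

/-- The weak-* topology of `B(Ω)⁺`, as a subset of the dual of `C₀(Ω)`: the coarsest topology for
which all the maps `μ ↦ μ(f) = ∫ f dμ`, `f ∈ C₀(Ω)`, are continuous. -/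
instance [TopologicalSpace Ω] : TopologicalSpace (SubprobabilityMeasure Ω) :=
  TopologicalSpace.induced
    (fun (μ : SubprobabilityMeasure Ω) (f : C₀(Ω, ℂ)) => ∫ x, f x ∂μ.toMeasure) inferInstance

/-- `B(Ω)⁺` carries the Borel `σ`-algebra of its weak-* topology. -/
instance [TopologicalSpace Ω] : MeasurableSpace (SubprobabilityMeasure Ω) := borel _

instance [TopologicalSpace Ω] : BorelSpace (SubprobabilityMeasure Ω) := ⟨rfl⟩

/-- The subset `P(Ω)` of probability measures in `B(Ω)⁺`. -/
def probabilityMeasures (Ω : Type*) [MeasurableSpace Ω] : Set (SubprobabilityMeasure Ω) :=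
  {μ | μ.toMeasure Set.univ = 1}

end SubprobabilityMeasure

/-- The representation `E(f) = ∫ μ(f) dP(μ)` for all `f ∈ C₀(Ω)`. -/
def POVM.RepresentsOnFunctions {Ω : Type*} [TopologicalSpace Ω] [MeasurableSpace Ω] {H : Type*}
    [NormedAddCommGroup H] [InnerProductSpace ℂ H] [CompleteSpace H]
    (P : POVM (SubprobabilityMeasure Ω) H) (E : POVM Ω H) : Prop :=
  ∀ f : C₀(Ω, ℂ), E.integral f =
    P.integral (fun μ : SubprobabilityMeasure Ω => ∫ x, f x ∂μ.toMeasure)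

/-- The representation `E(X) = ∫ μ(X) dP(μ)` for all Borel sets `X`. -/
def POVM.RepresentsOnSets {Ω : Type*} [TopologicalSpace Ω] [MeasurableSpace Ω] {H : Type*}
    [NormedAddCommGroup H] [InnerProductSpace ℂ H] [CompleteSpace H]
    (P : POVM (SubprobabilityMeasure Ω) H) (E : POVM Ω H) : Prop :=
  ∀ X : Set Ω, MeasurableSet X →
    E X = P.integral (fun μ : SubprobabilityMeasure Ω => ((μ.toMeasure.real X : ℝ) : ℂ))

end

noncomputable section

open scoped ComplexOrder CompactlySupported

/-! The representing PVM comes from Gelfand duality. Since `E` is commutative, the operators E(f), f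
∈ C₀(Ω), generate a commutative unital C⋆-algebra A. Composing a character of A with f ↦ E(f) gives
a positive functional on C₀(Ω) bounded by one, that is, by Riesz, a point of B(Ω)⁺. This defines a
continuous map m from the character space of A to B(Ω)⁺. Pulling back along m and inverting the
Gelfand transform yields a star homomorphism π from C(B(Ω)⁺) to the bounded operators with π(μ ↦
μ(f)) = E(f) (`IsCommutative.exists_starAlgHom`). As B(Ω)⁺ is compact, Hausdorff and second
countable, the spectral theorem `exists_isSharp_of_starAlgHom` turns π into a PVM.

Uniqueness and the equality of commutants rest on Stone–Weierstrass: the functions μ ↦ μ(f) separate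
points, so the unital star algebra they generate is dense in C(B(Ω)⁺), and a sharp integral is a
continuous star homomorphism there.

Conditions (1) and (2) both say that each scalar measure of `E` is the mixture of the measures μ
under the corresponding scalar measure of `P`. Comparing total masses in this mixture forces μ(Ω) =
1 almost everywhere. -/

theorem integral_indicator_one_complex {α : Type*} [MeasurableSpace α] (μ : Measure α) {X : Set α}
    (hX : MeasurableSet X) : ∫ x, X.indicator (1 : α → ℂ) x ∂μ = ((μ.real X : ℝ) : ℂ) := by
  rw [integral_indicator hX]
  simp

/-! ### Functions vanishing at infinity -/

section ZeroAtInfty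

variable {Ω : Type*} [TopologicalSpace Ω]

/-- Composition of a function vanishing at infinity with a continuous function fixing zero. -/
def ZeroAtInftyContinuousMap.postcomp {β γ : Type*} [TopologicalSpace β] [Zero β]
    [TopologicalSpace γ] [Zero γ] (φ : C(β, γ)) (hφ : φ 0 = 0) (f : C₀(Ω, β)) : C₀(Ω, γ) where
  toContinuousMap := φ.comp f.toContinuousMap
  zero_at_infty' := by
    have := (φ.continuous.tendsto 0).comp f.zero_at_infty'
    rwa [hφ] at this

@[simp]
theorem ZeroAtInftyContinuousMap.postcomp_apply {β γ : Type*} [TopologicalSpace β] [Zero β]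
    [TopologicalSpace γ] [Zero γ] (φ : C(β, γ)) (hφ : φ 0 = 0) (f : C₀(Ω, β)) (x : Ω) :
    f.postcomp φ hφ x = φ (f x) := rfl

/-- The complexification of a real compactly supported function, as a function vanishing at
infinity. -/
def CompactlySupportedContinuousMap.toComplexZeroAtInfty :
    C_c(Ω, ℝ) →ₗ[ℝ] C₀(Ω, ℂ) where
  toFun f :=
    { toFun := fun x => (f x : ℂ)
      continuous_toFun := Complex.continuous_ofReal.comp f.continuous
      zero_at_infty' :=
        (f.hasCompactSupport.comp_left (g := ((↑) : ℝ → ℂ)) Complex.ofReal_zero).is_zero_at_infty }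
  map_add' f g := by ext x; simp
  map_smul' c f := by ext x; simp

@[simp]
theorem CompactlySupportedContinuousMap.toComplexZeroAtInfty_apply (f : C_c(Ω, ℝ)) (x : Ω) :
    toComplexZeroAtInfty f x = (f x : ℂ) := rfl

theorem ZeroAtInftyContinuousMap.norm_apply_le (f : C₀(Ω, ℂ)) (x : Ω) : ‖f x‖ ≤ ‖f‖ :=
  f.toBCF.norm_coe_le_norm x

theorem ZeroAtInftyContinuousMap.measurable [MeasurableSpace Ω] [OpensMeasurableSpace Ω]
    (f : C₀(Ω, ℂ)) : Measurable f :=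
  (map_continuous f).measurable

theorem ZeroAtInftyContinuousMap.integrable [MeasurableSpace Ω] [OpensMeasurableSpace Ω]
    (f : C₀(Ω, ℂ)) (μ : Measure Ω) [IsFiniteMeasure μ] : Integrable f μ :=
  Integrable.of_bound f.measurable.aestronglyMeasurable ‖f‖ (ae_of_all _ f.norm_apply_le)

/-- A nonnegative function vanishing at infinity is a limit of compactly supported ones. -/
theorem ZeroAtInftyContinuousMap.exists_compactlySupported_sub_le {f : C₀(Ω, ℂ)}
    (hf : ∀ x, 0 ≤ f x) {ε : ℝ} (hε : 0 < ε) :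
    ∃ g : C_c(Ω, ℝ), ∀ x, 0 ≤ g x ∧ 0 ≤ f x - g x ∧ f x - g x ≤ ε := by
  -- The approximant is (Re f - ε)⁺, which vanishes wherever |f| < ε, hence off a compact set.
  have hsupp : HasCompactSupport (fun x => max ((f x).re - ε) 0) := by
    have h : ∀ᶠ x in cocompact Ω, ‖f x‖ < ε := by
      have := f.zero_at_infty'.norm
      rw [norm_zero] at this
      exact this.eventually (gt_mem_nhds hε)
    obtain ⟨K, hK, hKf⟩ := mem_cocompact'.1 h
    refine HasCompactSupport.intro' (K := closure {x | ε ≤ ‖f x‖}) ?_ isClosed_closure ?_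
    · have hc : IsClosed {x | ε ≤ ‖f x‖} :=
        isClosed_le continuous_const (map_continuous f).norm
      rw [hc.closure_eq]
      exact hK.of_isClosed_subset hc fun x hx => hKf (by simpa using hx)
    · intro x hx
      have : ¬ ε ≤ ‖f x‖ := fun h => hx (subset_closure h)
      have h2 := (Complex.re_le_norm (f x))
      exact max_eq_right (by linarith)
  refine ⟨⟨⟨fun x => max ((f x).re - ε) 0, ?_⟩, hsupp⟩, fun x => ?_⟩
  · have := map_continuous f
    fun_prop
  · obtain ⟨h1, h2⟩ := Complex.nonneg_iff.1 (hf x)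
    change 0 ≤ max ((f x).re - ε) 0 ∧ 0 ≤ f x - (max ((f x).re - ε) 0 : ℝ) ∧
      f x - (max ((f x).re - ε) 0 : ℝ) ≤ ε
    refine ⟨le_max_right _ _, ?_, ?_⟩
    · rw [Complex.nonneg_iff]
      simp only [Complex.sub_re, Complex.ofReal_re, Complex.sub_im, Complex.ofReal_im, ← h2]
      refine ⟨?_, by simp⟩
      rw [sub_nonneg]
      exact max_le (by linarith) h1
    · rw [Complex.le_def]
      simp only [Complex.sub_re, Complex.ofReal_re, Complex.sub_im, Complex.ofReal_im, ← h2]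
      refine ⟨?_, by simp⟩
      have := le_max_left ((f x).re - ε) 0
      linarith

/-- Every function vanishing at infinity is a linear combination of four nonnegative ones. -/
theorem ZeroAtInftyContinuousMap.exists_nonneg_decomposition (f : C₀(Ω, ℂ)) :
    ∃ a b c d : C₀(Ω, ℂ), (∀ x, 0 ≤ a x) ∧ (∀ x, 0 ≤ b x) ∧ (∀ x, 0 ≤ c x) ∧ (∀ x, 0 ≤ d x) ∧
      f = a - b + Complex.I • (c - d) := by
  refine ⟨f.postcomp ⟨fun z => ((max z.re 0 : ℝ) : ℂ), by fun_prop⟩ (by simp),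
    f.postcomp ⟨fun z => ((max (-z.re) 0 : ℝ) : ℂ), by fun_prop⟩ (by simp),
    f.postcomp ⟨fun z => ((max z.im 0 : ℝ) : ℂ), by fun_prop⟩ (by simp),
    f.postcomp ⟨fun z => ((max (-z.im) 0 : ℝ) : ℂ), by fun_prop⟩ (by simp),
    fun x => ?_, fun x => ?_, fun x => ?_, fun x => ?_, ?_⟩
  · simp only [postcomp_apply, ContinuousMap.coe_mk]; exact_mod_cast le_max_right _ _
  · simp only [postcomp_apply, ContinuousMap.coe_mk]; exact_mod_cast le_max_right _ _
  · simp only [postcomp_apply, ContinuousMap.coe_mk]; exact_mod_cast le_max_right _ _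
  · simp only [postcomp_apply, ContinuousMap.coe_mk]; exact_mod_cast le_max_right _ _
  · have key : ∀ t : ℝ, max t 0 - max (-t) 0 = t := fun t => by
      rcases le_total t 0 with h | h
      · rw [max_eq_right h, max_eq_left (by linarith)]; ring
      · rw [max_eq_left h, max_eq_right (by linarith)]; ring
    ext x
    simp only [add_apply, sub_apply, smul_apply, postcomp_apply, ContinuousMap.coe_mk,
      smul_eq_mul, ← Complex.ofReal_sub, key]
    rw [mul_comm, Complex.re_add_im]

end ZeroAtInfty

/-! ### Finite measures as functionals on C₀(Ω) -/

section LocallyCompact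

variable {Ω : Type*} [TopologicalSpace Ω] [T2Space Ω] [LocallyCompactSpace Ω]
  [SecondCountableTopology Ω]

/-- The indicator of an open set is a pointwise limit of compactly supported functions with values
in the unit interval. -/
theorem IsOpen.exists_compactlySupported_tendsto_indicator {U : Set Ω} (hU : IsOpen U) :
    ∃ f : ℕ → C_c(Ω, ℝ), (∀ n x, f n x ∈ Set.Icc (0 : ℝ) 1) ∧
      ∀ x, Tendsto (fun n => f n x) atTop (𝓝 (U.indicator 1 x)) := by
  -- Metrizability makes U an increasing union of closed sets; intersecting them with a compact
  -- exhaustion of Ω gives compacts K n that exhaust U. Urysohn functions equal to 1 on K n and 0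
  -- off U are eventually 1 at each point of U.
  let := TopologicalSpace.metrizableSpaceMetric Ω
  obtain ⟨F, hF, hFU, hUn, hmono⟩ := hU.exists_iUnion_isClosed
  have hK : ∀ n, IsCompact (compactCovering Ω n ∩ F n) := fun n =>
    (isCompact_compactCovering Ω n).inter_right (hF n)
  have hd : ∀ n, Disjoint (compactCovering Ω n ∩ F n) Uᶜ := fun n =>
    Set.disjoint_compl_right_iff_subset.2 (Set.inter_subset_right.trans (hFU n))
  choose f hf1 hf0 hfs hfI using fun n =>
    exists_continuous_one_zero_of_isCompact (hK n) hU.isClosed_compl (hd n)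
  refine ⟨fun n => ⟨f n, hfs n⟩, fun n x => hfI n x, fun x => ?_⟩
  by_cases hx : x ∈ U
  · obtain ⟨m, hm⟩ := Set.mem_iUnion.1 (hUn ▸ hx)
    obtain ⟨k, hk⟩ := exists_mem_compactCovering x
    refine tendsto_const_nhds.congr' ?_
    filter_upwards [eventually_ge_atTop (max m k)] with n hn
    rw [Set.indicator_of_mem hx]
    exact (hf1 n ⟨compactCovering_subset Ω ((le_max_right m k).trans hn) hk,
      hmono ((le_max_left m k).trans hn) hm⟩).symm
  · refine tendsto_const_nhds.congr fun n => ?_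
    rw [Set.indicator_of_notMem hx]
    exact (hf0 n hx).symm

theorem IsOpen.exists_zeroAtInfty_tendsto_indicator {U : Set Ω} (hU : IsOpen U) :
    ∃ f : ℕ → C₀(Ω, ℂ), (∀ n x, ‖f n x‖ ≤ 1) ∧
      ∀ x, Tendsto (fun n => f n x) atTop (𝓝 (U.indicator 1 x)) := by
  obtain ⟨f, hf, hlim⟩ := hU.exists_compactlySupported_tendsto_indicator
  refine ⟨fun n => (f n).toComplexZeroAtInfty, fun n x => ?_, fun x => ?_⟩
  · simpa [abs_of_nonneg (hf n x).1] using (hf n x).2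
  · have := (Complex.continuous_ofReal.tendsto _).comp (hlim x)
    refine (this.congr fun n => by simp).trans (le_of_eq ?_)
    by_cases hx : x ∈ U <;> simp [hx]

variable [MeasurableSpace Ω] [BorelSpace Ω]

/-- Finite measures that agree on functions vanishing at infinity are equal. -/
theorem MeasureTheory.Measure.ext_of_forall_integral_zeroAtInfty {μ ν : Measure Ω}
    [IsFiniteMeasure μ] [IsFiniteMeasure ν]
    (h : ∀ f : C₀(Ω, ℂ), ∫ x, f x ∂μ = ∫ x, f x ∂ν) : μ = ν := by
  have hopen : ∀ U : Set Ω, IsOpen U → μ U = ν U := by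
    intro U hU
    obtain ⟨f, hf, hlim⟩ := hU.exists_zeroAtInfty_tendsto_indicator
    have key : ∀ (κ : Measure Ω) [IsFiniteMeasure κ],
        Tendsto (fun n => ∫ x, f n x ∂κ) atTop (𝓝 ((κ.real U : ℝ) : ℂ)) := by
      intro κ _
      have := tendsto_integral_of_dominated_convergence (μ := κ) (fun _ => (1 : ℝ))
        (fun n => (f n).measurable.aestronglyMeasurable) (integrable_const 1)
        (fun n => ae_of_all _ (hf n)) (ae_of_all _ hlim)
      rwa [integral_indicator_one_complex κ hU.measurableSet] at this
    have h1 := tendsto_nhds_unique (key μ) ((key ν).congr fun n => (h (f n)).symm)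
    exact (measureReal_eq_measureReal_iff).1 (by exact_mod_cast h1)
  refine ext_of_generate_finite _ BorelSpace.measurable_eq
    isPiSystem_isOpen (fun U hU => hopen U hU) (hopen _ isOpen_univ)

/-- **Riesz representation**: a bounded positive functional on the functions vanishing at infinity
is the integral against a finite measure. -/
theorem exists_measure_of_positive_functional (Λ : C₀(Ω, ℂ) →ₗ[ℂ] ℂ) {C : ℝ}
    (hpos : ∀ f : C₀(Ω, ℂ), (∀ x, 0 ≤ f x) → 0 ≤ Λ f)
    (hC : ∀ f : C₀(Ω, ℂ), (∀ x, 0 ≤ f x) → (∀ x, f x ≤ 1) → Λ f ≤ C) :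
    ∃ μ : Measure Ω, μ Set.univ ≤ ENNReal.ofReal C ∧ ∀ f : C₀(Ω, ℂ), Λ f = ∫ x, f x ∂μ := by
  let Λr : C_c(Ω, ℝ) →ₚ[ℝ] ℝ := PositiveLinearMap.mk₀
    (Complex.reLm ∘ₗ (Λ.restrictScalars ℝ) ∘ₗ
      CompactlySupportedContinuousMap.toComplexZeroAtInfty)
    (fun f hf => (Complex.nonneg_iff.1 (hpos _ fun x => by simpa using hf x)).1)
  have hΛr : ∀ f : C_c(Ω, ℝ), Λr f = (Λ f.toComplexZeroAtInfty).re := fun f => rfl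
  let μ := RealRMK.rieszMeasure Λr
  have hμ : ∀ f : C_c(Ω, ℝ), ∫ x, f x ∂μ = Λr f := RealRMK.integral_rieszMeasure Λr
  have hmass : μ Set.univ ≤ ENNReal.ofReal C := by
    obtain ⟨f, hf, hlim⟩ := (isOpen_univ (X := Ω)).exists_compactlySupported_tendsto_indicator
    have hle : ∀ n, ∫⁻ x, ENNReal.ofReal (f n x) ∂μ ≤ ENNReal.ofReal C := by
      intro n
      have hi : Integrable (fun x => f n x) μ :=
        (f n).continuous.integrable_of_hasCompactSupport (f n).hasCompactSupport
      rw [← ofReal_integral_eq_lintegral_ofReal hi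
        (ae_of_all _ fun x => (hf n x).1), hμ, hΛr]
      refine ENNReal.ofReal_le_ofReal ?_
      have := hC (f n).toComplexZeroAtInfty (fun x => by simpa using (hf n x).1)
        (fun x => by
          rw [CompactlySupportedContinuousMap.toComplexZeroAtInfty_apply]
          exact_mod_cast (hf n x).2)
      exact (Complex.le_def.1 this).1
    -- The functions f n tend to 1 but need not be monotone, so the mass bound comes from Fatou's
    -- lemma.
    calc μ Set.univ = ∫⁻ x, liminf (fun n => ENNReal.ofReal (f n x)) atTop ∂μ := by
          rw [← lintegral_one]
          refine lintegral_congr fun x => ?_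
          have : Tendsto (fun n => ENNReal.ofReal (f n x)) atTop _ :=
            (ENNReal.continuous_ofReal.tendsto _).comp (hlim x)
          rw [Tendsto.liminf_eq this]
          simp
      _ ≤ liminf (fun n => ∫⁻ x, ENNReal.ofReal (f n x) ∂μ) atTop :=
          lintegral_liminf_le fun n => (f n).continuous.measurable.ennreal_ofReal
      _ ≤ ENNReal.ofReal C := by
          refine liminf_le_of_le (by isBoundedDefault) fun b hb => ?_
          obtain ⟨n, hn⟩ := hb.exists
          exact hn.trans (hle n)
  have : IsFiniteMeasure μ := ⟨hmass.trans_lt ENNReal.ofReal_lt_top⟩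
  have hnonneg : ∀ f : C₀(Ω, ℂ), (∀ x, 0 ≤ f x) → Λ f = ∫ x, f x ∂μ := by
    intro f hf
    let ε : ℕ → ℝ := fun n => 1 / ((n : ℝ) + 1)
    have hε : ∀ n, 0 < ε n := fun n => Nat.one_div_pos_of_nat
    have hε0 : Tendsto ε atTop (𝓝 0) := tendsto_one_div_add_atTop_nhds_zero_nat
    choose g hg using fun n => f.exists_compactlySupported_sub_le hf (hε n)
    have hgeq : ∀ n, Λ (g n).toComplexZeroAtInfty = ∫ x, ((g n x : ℝ) : ℂ) ∂μ := by
      intro n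
      have h := hpos (g n).toComplexZeroAtInfty (fun x => by simpa using (hg n x).1)
      rw [integral_complex_ofReal, hμ, hΛr]
      exact Complex.ext rfl (by simpa using (Complex.nonneg_iff.1 h).2.symm)
    have hgn : ∀ n x, ‖f x - g n x‖ ≤ ε n := by
      intro n x
      rw [← Complex.norm_of_nonneg (hε n).le]
      exact CStarAlgebra.norm_le_norm_of_nonneg_of_le (hg n x).2.1 (hg n x).2.2
    have h1 : Tendsto (fun n => Λ (g n).toComplexZeroAtInfty) atTop (𝓝 (Λ f)) := by
      rw [tendsto_iff_norm_sub_tendsto_zero]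
      refine squeeze_zero (fun n => norm_nonneg _) (fun n => ?_)
        (show Tendsto (fun n => ε n * |C|) atTop (𝓝 0) by simpa using hε0.mul_const |C|)
      have hp := hpos (f - (g n).toComplexZeroAtInfty) (fun x => (hg n x).2.1)
      -- The rescaled difference ε⁻¹(f - g) lies between 0 and 1, so the mass bound gives Λ(f - g) ≤
      -- ε C. This replaces a continuity assumption on Λ.
      have hb := hC (((ε n)⁻¹ : ℂ) • (f - (g n).toComplexZeroAtInfty)) (fun x => ?_) (fun x => ?_)
      · rw [norm_sub_rev, ← map_sub]
        rw [map_smul, smul_eq_mul] at hb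
        have hr : Λ (f - (g n).toComplexZeroAtInfty) =
          ((Λ (f - (g n).toComplexZeroAtInfty)).re : ℂ) :=
          Complex.ext rfl (by simpa using (Complex.nonneg_iff.1 hp).2.symm)
        rw [hr] at hb hp ⊢
        rw [Complex.norm_of_nonneg (by exact_mod_cast hp)]
        have hb' : (ε n)⁻¹ * (Λ (f - (g n).toComplexZeroAtInfty)).re ≤ C := by exact_mod_cast hb
        rw [inv_mul_le_iff₀ (hε n)] at hb'
        exact hb'.trans (mul_le_mul_of_nonneg_left (le_abs_self C) (hε n).le)
      · have h : (0 : ℂ) ≤ ((ε n : ℝ) : ℂ)⁻¹ := by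
          rw [← Complex.ofReal_inv]; exact_mod_cast (inv_pos.2 (hε n)).le
        exact mul_nonneg h (hg n x).2.1
      · have h : (0 : ℂ) ≤ ((ε n : ℝ) : ℂ)⁻¹ := by
          rw [← Complex.ofReal_inv]; exact_mod_cast (inv_pos.2 (hε n)).le
        refine (mul_le_mul_of_nonneg_left (hg n x).2.2 h).trans (le_of_eq ?_)
        exact inv_mul_cancel₀ (by exact_mod_cast (hε n).ne')
    have h2 : Tendsto (fun n => ∫ x, ((g n x : ℝ) : ℂ) ∂μ) atTop (𝓝 (∫ x, f x ∂μ)) := by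
      refine tendsto_integral_of_dominated_convergence (fun _ => ‖f‖)
        (fun n => (g n).toComplexZeroAtInfty.measurable.aestronglyMeasurable)
        (integrable_const _) (fun n => ae_of_all _ fun x => ?_) (ae_of_all _ fun x => ?_)
      · refine le_trans ?_ (f.norm_apply_le x)
        exact CStarAlgebra.norm_le_norm_of_nonneg_of_le (by exact_mod_cast (hg n x).1)
          (sub_nonneg.1 (hg n x).2.1)
      · rw [tendsto_iff_norm_sub_tendsto_zero]
        exact squeeze_zero (fun n => norm_nonneg _)
          (fun n => by rw [norm_sub_rev]; exact hgn n x) hε0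
    exact tendsto_nhds_unique h1 (h2.congr fun n => (hgeq n).symm)
  refine ⟨μ, hmass, fun f => ?_⟩
  obtain ⟨a, b, c, d, ha, hb, hc, hd, rfl⟩ := f.exists_nonneg_decomposition
  have hi : ∀ f : C₀(Ω, ℂ), Integrable (fun x => f x) μ := fun f => f.integrable μ
  simp only [map_add, map_sub, map_smul, hnonneg a ha, hnonneg b hb, hnonneg c hc, hnonneg d hd,
    ZeroAtInftyContinuousMap.add_apply, ZeroAtInftyContinuousMap.sub_apply,
    ZeroAtInftyContinuousMap.smul_apply]
  have hab : Integrable (fun x => a x - b x) μ := (hi a).sub (hi b)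
  have hcd : Integrable (fun x => Complex.I • (c x - d x)) μ := ((hi c).sub (hi d)).smul Complex.I
  rw [integral_add hab hcd, integral_sub (hi a) (hi b), integral_smul, integral_sub (hi c) (hi d)]

end LocallyCompact

/-! ### B(Ω)⁺ as a compact, second countable Hausdorff space -/

namespace SubprobabilityMeasure

variable {Ω : Type*} [MeasurableSpace Ω]

instance (μ : SubprobabilityMeasure Ω) : IsFiniteMeasure μ.toMeasure :=
  ⟨μ.measure_univ_le_one.trans_lt ENNReal.one_lt_top⟩

theorem toMeasure_injective :
    Function.Injective (toMeasure : SubprobabilityMeasure Ω → Measure Ω) := by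
  rintro ⟨μ, _⟩ ⟨ν, _⟩ rfl
  rfl

theorem norm_integral_le (μ : SubprobabilityMeasure Ω) {f : Ω → ℂ} {C : ℝ} (hC0 : 0 ≤ C)
    (hC : ∀ x, ‖f x‖ ≤ C) : ‖∫ x, f x ∂μ.toMeasure‖ ≤ C := by
  refine (norm_integral_le_of_norm_le_const (ae_of_all _ hC)).trans ?_
  refine mul_le_of_le_one_right hC0 ?_
  exact ENNReal.toReal_le_of_le_ofReal zero_le_one (by simpa using μ.measure_univ_le_one)

variable [TopologicalSpace Ω]

theorem isInducing_integral :
    Topology.IsInducing (fun (μ : SubprobabilityMeasure Ω) (f : C₀(Ω, ℂ)) => ∫ x, f x ∂μ.toMeasure) :=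
  ⟨rfl⟩

theorem continuous_integral (f : C₀(Ω, ℂ)) :
    Continuous fun μ : SubprobabilityMeasure Ω => ∫ x, f x ∂μ.toMeasure :=
  (continuous_apply f).comp isInducing_integral.continuous

/-- The continuous function `μ ↦ μ(f)` on `B(Ω)⁺`. -/
def evalMap (f : C₀(Ω, ℂ)) : C(SubprobabilityMeasure Ω, ℂ) :=
  ⟨fun μ => ∫ x, f x ∂μ.toMeasure, continuous_integral f⟩

theorem coe_evalMap (f : C₀(Ω, ℂ)) :
    ⇑(evalMap f) = fun μ : SubprobabilityMeasure Ω => ∫ x, f x ∂μ.toMeasure := rfl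

variable [T2Space Ω] [LocallyCompactSpace Ω] [SecondCountableTopology Ω] [BorelSpace Ω]

theorem ext_of_integral_eq {μ ν : SubprobabilityMeasure Ω}
    (h : ∀ f : C₀(Ω, ℂ), ∫ x, f x ∂μ.toMeasure = ∫ x, f x ∂ν.toMeasure) : μ = ν :=
  toMeasure_injective (Measure.ext_of_forall_integral_zeroAtInfty h)

instance : T2Space (SubprobabilityMeasure Ω) :=
  .of_injective_continuous (fun _ _ h => ext_of_integral_eq (congrFun h))
    isInducing_integral.continuous

theorem exists_of_positive_functional (Λ : C₀(Ω, ℂ) →ₗ[ℂ] ℂ)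
    (hpos : ∀ f : C₀(Ω, ℂ), (∀ x, 0 ≤ f x) → 0 ≤ Λ f)
    (hle : ∀ f : C₀(Ω, ℂ), (∀ x, 0 ≤ f x) → (∀ x, f x ≤ 1) → Λ f ≤ 1) :
    ∃ μ : SubprobabilityMeasure Ω, ∀ f : C₀(Ω, ℂ), Λ f = ∫ x, f x ∂μ.toMeasure := by
  obtain ⟨μ, hμ, h⟩ := exists_measure_of_positive_functional Λ (C := 1) hpos (by simpa using hle)
  exact ⟨⟨μ, by simpa using hμ⟩, h⟩

/-- By Riesz representation, B(Ω)⁺ is cut out of the product of copies of ℂ by conditions that each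
involve finitely many coordinates and are closed. This is what compactness needs. -/
theorem range_integral_eq :
    Set.range (fun (μ : SubprobabilityMeasure Ω) (f : C₀(Ω, ℂ)) => ∫ x, f x ∂μ.toMeasure) =
      {Λ | (∀ f g, Λ (f + g) = Λ f + Λ g) ∧ (∀ (c : ℂ) f, Λ (c • f) = c • Λ f) ∧
        (∀ f, (∀ x, 0 ≤ f x) → 0 ≤ Λ f) ∧
        ∀ f, (∀ x, 0 ≤ f x) → (∀ x, f x ≤ 1) → Λ f ≤ 1} := by
  ext Λ
  constructor
  · rintro ⟨μ, rfl⟩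
    refine ⟨fun f g => ?_, fun c f => ?_, fun f hf => ?_, fun f hf hf1 => ?_⟩
    · exact integral_add (f.integrable μ.toMeasure) (g.integrable μ.toMeasure)
    · exact integral_smul c f
    · exact integral_nonneg hf
    · refine (integral_mono (f.integrable μ.toMeasure) (integrable_const 1) hf1).trans ?_
      have : μ.toMeasure.real Set.univ ≤ 1 :=
        ENNReal.toReal_le_of_le_ofReal zero_le_one (by simpa using μ.measure_univ_le_one)
      rw [integral_const, Complex.real_smul, mul_one]
      exact_mod_cast this
  · rintro ⟨hadd, hsmul, hpos, hle⟩
    obtain ⟨μ, hμ⟩ := exists_of_positive_functional ⟨⟨Λ, hadd⟩, hsmul⟩ hpos hle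
    exact ⟨μ, funext fun f => (hμ f).symm⟩

/-- As in Banach–Alaoglu: the image is closed in a product of closed discs of radius ‖f‖, which is
compact by Tychonoff. -/
instance : CompactSpace (SubprobabilityMeasure Ω) := by
  refine ⟨isInducing_integral.isCompact_iff.2 ?_⟩
  rw [Set.image_univ]
  refine (isCompact_univ_pi fun f : C₀(Ω, ℂ) =>
    isCompact_closedBall (0 : ℂ) ‖f‖).of_isClosed_subset ?_ ?_
  · rw [range_integral_eq]
    simp only [Set.ofPred_and, Set.ofPred_forall]
    refine (isClosed_iInter fun f => isClosed_iInter fun g => ?_).inter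
      ((isClosed_iInter fun c => isClosed_iInter fun f => ?_).inter
      ((isClosed_iInter fun f => isClosed_iInter fun hf => ?_).inter
      (isClosed_iInter fun f => isClosed_iInter fun hf => isClosed_iInter fun hf1 => ?_)))
    · exact isClosed_eq (continuous_apply _) (by fun_prop)
    · exact isClosed_eq (continuous_apply _) ((continuous_apply _).const_smul c)
    · exact isClosed_le continuous_const (continuous_apply _)
    · exact isClosed_le (continuous_apply _) continuous_const
  · rintro _ ⟨μ, rfl⟩ f -
    simpa using μ.norm_integral_le (norm_nonneg f) f.norm_apply_le

/-- A countable set of functions vanishing at infinity separates the measures. -/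
theorem exists_countable_separating : ∃ D : Set C₀(Ω, ℂ), D.Countable ∧
    ∀ μ ν : SubprobabilityMeasure Ω,
      (∀ f ∈ D, ∫ x, f x ∂μ.toMeasure = ∫ x, f x ∂ν.toMeasure) → μ = ν := by
  -- The unit ball gets the compact-open topology, which is second countable. Convergence there is
  -- pointwise with uniform bound 1, so dominated convergence carries equality of integrals from a
  -- dense sequence to the whole ball.
  let T := {f : C₀(Ω, ℂ) // ‖f‖ ≤ 1}
  let j : T → C(Ω, ℂ) := fun f => f.1.toContinuousMap
  let : TopologicalSpace T := TopologicalSpace.induced j inferInstance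
  have hj : Topology.IsInducing j := ⟨rfl⟩
  have : SecondCountableTopology T := hj.secondCountableTopology
  obtain ⟨D, hD, hDd⟩ := TopologicalSpace.exists_countable_dense T
  refine ⟨Subtype.val '' D, hD.image _, fun μ ν h => ext_of_integral_eq ?_⟩
  have hball : ∀ f : T, ∫ x, f.1 x ∂μ.toMeasure = ∫ x, f.1 x ∂ν.toMeasure := by
    intro f
    obtain ⟨u, huD, hu⟩ := mem_closure_iff_seq_limit.1 (hDd f)
    have hpt : ∀ x, Tendsto (fun n => (u n).1 x) atTop (𝓝 (f.1 x)) := fun x =>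
      (((continuous_eval_const x : Continuous fun g : C(Ω, ℂ) => g x).comp hj.continuous).tendsto
        f).comp hu
    have key : ∀ κ : SubprobabilityMeasure Ω, Tendsto (fun n => ∫ x, (u n).1 x ∂κ.toMeasure) atTop
        (𝓝 (∫ x, f.1 x ∂κ.toMeasure)) := fun κ =>
      tendsto_integral_of_dominated_convergence (fun _ => 1)
        (fun n => (u n).1.measurable.aestronglyMeasurable) (integrable_const _)
        (fun n => ae_of_all _ fun x => ((u n).1.norm_apply_le x).trans (u n).2)
        (ae_of_all _ hpt)
    exact tendsto_nhds_unique (key μ)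
      ((key ν).congr fun n => (h _ ⟨u n, huD n, rfl⟩).symm)
  intro f
  -- Scaling by 1/(‖f‖ + 1) moves f into the unit ball; the added 1 covers f = 0.
  have h1 := hball ⟨((‖f‖ + 1 : ℝ)⁻¹ : ℂ) • f, by
    rw [norm_smul, norm_inv, Complex.norm_of_nonneg (by positivity), inv_mul_le_iff₀ (by positivity)]
    linarith⟩
  have h2 : ∀ κ : SubprobabilityMeasure Ω,
      ∫ x, (((‖f‖ + 1 : ℝ)⁻¹ : ℂ) • f) x ∂κ.toMeasure =
        ((‖f‖ + 1 : ℝ)⁻¹ : ℂ) • ∫ x, f x ∂κ.toMeasure := fun κ =>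
    integral_smul ((‖f‖ + 1 : ℝ)⁻¹ : ℂ) fun x => f x
  rw [h2, h2] at h1
  refine smul_right_injective ℂ (inv_ne_zero ?_) h1
  exact_mod_cast (by positivity : ‖f‖ + 1 ≠ 0)

/-- A continuous injection of a compact space into a countable power of ℂ is an embedding. -/
instance : SecondCountableTopology (SubprobabilityMeasure Ω) := by
  obtain ⟨D, hD, hsep⟩ := exists_countable_separating (Ω := Ω)
  have : Countable D := hD
  have hc : Continuous fun (μ : SubprobabilityMeasure Ω) (f : D) => ∫ x, f.1 x ∂μ.toMeasure :=
    continuous_pi fun f => continuous_integral f.1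
  exact (hc.isClosedEmbedding fun μ ν h =>
    hsep μ ν fun f hf => congrFun h ⟨f, hf⟩).isEmbedding.isInducing.secondCountableTopology

/-- For open U, μ(U) is a limit of the continuous functions μ(f n), by dominated convergence. Open
sets form a π-system generating the Borel sets. -/
theorem measurable_toMeasure :
    Measurable (toMeasure : SubprobabilityMeasure Ω → Measure Ω) := by
  have hopen : ∀ U : Set Ω, IsOpen U →
      Measurable fun μ : SubprobabilityMeasure Ω => μ.toMeasure U := by
    intro U hU
    obtain ⟨f, hf, hlim⟩ := hU.exists_zeroAtInfty_tendsto_indicator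
    have h : Measurable fun μ : SubprobabilityMeasure Ω => ((μ.toMeasure.real U : ℝ) : ℂ) := by
      refine measurable_of_tendsto_metrizable (fun n => (continuous_integral (f n)).measurable)
        (tendsto_pi_nhds.2 fun μ => ?_)
      have := tendsto_integral_of_dominated_convergence (μ := μ.toMeasure) (fun _ => (1 : ℝ))
        (fun n => (f n).measurable.aestronglyMeasurable) (integrable_const 1)
        (fun n => ae_of_all _ (hf n)) (ae_of_all _ hlim)
      rwa [integral_indicator_one_complex _ hU.measurableSet] at this
    simpa [ofReal_measureReal] using (Complex.measurable_re.comp h).ennreal_ofReal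
  exact Measurable.measure_of_isPiSystem BorelSpace.measurable_eq isPiSystem_isOpen hopen
    (hopen _ isOpen_univ)

/-- The tautological kernel from `B(Ω)⁺` to `Ω`. -/
def kernel (Ω : Type*) [TopologicalSpace Ω] [T2Space Ω] [LocallyCompactSpace Ω]
    [SecondCountableTopology Ω] [MeasurableSpace Ω] [BorelSpace Ω] :
    ProbabilityTheory.Kernel (SubprobabilityMeasure Ω) Ω :=
  ⟨toMeasure, measurable_toMeasure⟩

@[simp]
theorem kernel_apply (μ : SubprobabilityMeasure Ω) : kernel Ω μ = μ.toMeasure := rfl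

instance : ProbabilityTheory.IsFiniteKernel (kernel Ω) :=
  ⟨1, ENNReal.one_lt_top, fun μ => μ.measure_univ_le_one⟩

theorem measurableSet_probabilityMeasures : MeasurableSet (probabilityMeasures Ω) :=
  (Measure.measurable_coe MeasurableSet.univ).comp measurable_toMeasure
    (measurableSet_singleton 1)

end SubprobabilityMeasure

/-! ### Polarization and weak limits of operators -/

section WeakOperatorLimits

variable {H : Type*} [NormedAddCommGroup H] [InnerProductSpace ℂ H]

theorem ContinuousLinearMap.ext_of_inner_self {A B : H →L[ℂ] H}
    (h : ∀ ψ, ⟪ψ, A ψ⟫_ℂ = ⟪ψ, B ψ⟫_ℂ) : A = B := by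
  have : (A : H →ₗ[ℂ] H) = (B : H →ₗ[ℂ] H) := by
    rw [← ext_inner_map]
    intro ψ
    have h2 := congrArg (starRingEnd ℂ) (h ψ)
    simpa [inner_conj_symm] using h2
  ext x
  exact LinearMap.congr_fun this x

theorem ContinuousLinearMap.inner_polarization (A : H →L[ℂ] H) (φ ψ : H) :
    ⟪φ, A ψ⟫_ℂ = (⟪φ + ψ, A (φ + ψ)⟫_ℂ - ⟪φ - ψ, A (φ - ψ)⟫_ℂ
      - Complex.I * ⟪φ + Complex.I • ψ, A (φ + Complex.I • ψ)⟫_ℂ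
      + Complex.I * ⟪φ - Complex.I • ψ, A (φ - Complex.I • ψ)⟫_ℂ) / 4 := by
  have h := congrArg (starRingEnd ℂ) (inner_map_polarization (A : H →ₗ[ℂ] H) φ ψ)
  simp only [ContinuousLinearMap.coe_coe, inner_conj_symm, map_div₀, map_sub, map_add, map_mul,
    Complex.conj_I] at h
  rw [h]
  simp only [map_ofNat, map_add, map_sub]
  ring

theorem ContinuousLinearMap.tendsto_inner_of_tendsto_inner_self {ι : Type*} {l : Filter ι}
    {A : ι → H →L[ℂ] H} {q : H → ℂ}
    (h : ∀ ψ, Tendsto (fun i => ⟪ψ, A i ψ⟫_ℂ) l (𝓝 (q ψ))) (φ ψ : H) :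
    Tendsto (fun i => ⟪φ, A i ψ⟫_ℂ) l (𝓝 ((q (φ + ψ) - q (φ - ψ)
      - Complex.I * q (φ + Complex.I • ψ) + Complex.I * q (φ - Complex.I • ψ)) / 4)) :=
  Tendsto.congr (fun i => ((A i).inner_polarization φ ψ).symm)
    (((((h (φ + ψ)).sub (h (φ - ψ))).sub ((h (φ + Complex.I • ψ)).const_mul Complex.I)).add
      ((h (φ - Complex.I • ψ)).const_mul Complex.I)).div_const 4)

theorem ContinuousLinearMap.tendsto_inner_of_tendsto_inner_self' {ι : Type*} {l : Filter ι}
    {A : ι → H →L[ℂ] H} {B : H →L[ℂ] H}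
    (h : ∀ ψ, Tendsto (fun i => ⟪ψ, A i ψ⟫_ℂ) l (𝓝 ⟪ψ, B ψ⟫_ℂ)) (φ ψ : H) :
    Tendsto (fun i => ⟪φ, A i ψ⟫_ℂ) l (𝓝 ⟪φ, B ψ⟫_ℂ) := by
  rw [B.inner_polarization φ ψ]
  exact tendsto_inner_of_tendsto_inner_self h φ ψ

/-- A sequence of bounded operators whose quadratic forms converge pointwise converges weakly. -/
theorem ContinuousLinearMap.exists_of_tendsto_inner_self [CompleteSpace H]
    {A : ℕ → H →L[ℂ] H} {q : H → ℂ}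
    (h : ∀ ψ, Tendsto (fun n => ⟪ψ, A n ψ⟫_ℂ) atTop (𝓝 (q ψ))) :
    ∃ B : H →L[ℂ] H, ∀ ψ, ⟪ψ, B ψ⟫_ℂ = q ψ := by
  have hlim : ∀ x y, ∃ b, Tendsto (fun n => ⟪A n y, x⟫_ℂ) atTop (𝓝 b) := fun x y =>
    ⟨_, ((Complex.continuous_conj.tendsto _).comp
      (tendsto_inner_of_tendsto_inner_self h x y)).congr fun n => inner_conj_symm _ _⟩
  choose b hb using hlim
  -- Uniform boundedness is used twice: convergent, hence bounded, values ⟨A n y, x⟩ bound ‖A n y‖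
  -- for each y, and these bound ‖A n‖.
  obtain ⟨K, hK⟩ : ∃ K, ∀ n, ‖A n‖ ≤ K := by
    apply banach_steinhaus
    intro y
    obtain ⟨K, hK⟩ : ∃ K, ∀ n, ‖InnerProductSpace.toDual ℂ H (A n y)‖ ≤ K := by
      apply banach_steinhaus
      intro x
      obtain ⟨K, hK⟩ := (Metric.isBounded_range_of_tendsto _ (hb x y)).exists_norm_le
      exact ⟨K, fun n => by simpa using hK _ (Set.mem_range_self n)⟩
    exact ⟨K, fun n => by simpa using hK n⟩
  let B : H →ₗ⋆[ℂ] H →ₗ[ℂ] ℂ := LinearMap.mk₂'ₛₗ (starRingEnd ℂ) (RingHom.id ℂ) (fun y x => b x y)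
    (fun y y' x => tendsto_nhds_unique (hb _ _)
      (((hb x y).add (hb x y')).congr fun n => by rw [map_add, inner_add_left]))
    (fun c y x => tendsto_nhds_unique (hb _ _)
      (((hb x y).const_mul _).congr fun n => by rw [map_smul, inner_smul_left]))
    (fun y x x' => tendsto_nhds_unique (hb _ _)
      (((hb x y).add (hb x' y)).congr fun n => by rw [inner_add_right]))
    (fun c y x => tendsto_nhds_unique (hb _ _)
      (((hb x y).const_mul _).congr fun n => by rw [inner_smul_right]; rfl))
  have hBb : ∀ y x, ‖B y x‖ ≤ K * ‖y‖ * ‖x‖ := by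
    intro y x
    refine le_of_tendsto (hb x y).norm (Eventually.of_forall fun n => ?_)
    calc ‖⟪A n y, x⟫_ℂ‖ ≤ ‖A n y‖ * ‖x‖ := norm_inner_le_norm _ _
      _ ≤ K * ‖y‖ * ‖x‖ := by
        gcongr
        exact (A n).le_of_opNorm_le (hK n) y
  refine ⟨InnerProductSpace.continuousLinearMapOfBilin (B.mkContinuous₂ K hBb), fun ψ => ?_⟩
  rw [← inner_conj_symm, InnerProductSpace.continuousLinearMapOfBilin_apply,
    LinearMap.mkContinuous₂_apply]
  have : B ψ ψ = starRingEnd ℂ (q ψ) :=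
    tendsto_nhds_unique (hb ψ ψ) (((Complex.continuous_conj.tendsto _).comp (h ψ)).congr
      fun n => inner_conj_symm _ _)
  rw [this, Complex.conj_conj]

end WeakOperatorLimits

/-! ### Functional monotone class arguments -/

/-- Bounded measurable complex functions. -/
structure BoundedMeasurable {α : Type*} [MeasurableSpace α] (f : α → ℂ) : Prop where
  measurable : Measurable f
  bounded : ∃ C : ℝ, ∀ x, ‖f x‖ ≤ C

/-- A property of functions that is preserved by linear combinations of bounded measurable functions
and by bounded pointwise limits of sequences. -/
structure BoundedClosed {α : Type*} [MeasurableSpace α] (p : (α → ℂ) → Prop) : Prop where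
  add : ∀ f g, BoundedMeasurable f → BoundedMeasurable g → p f → p g → p (f + g)
  smul : ∀ (c : ℂ) f, BoundedMeasurable f → p f → p (c • f)
  lim : ∀ (F : ℕ → α → ℂ) (f : α → ℂ) (C : ℝ), (∀ n, Measurable (F n)) → (∀ n x, ‖F n x‖ ≤ C) →
    BoundedMeasurable f → (∀ x, Tendsto (fun n => F n x) atTop (𝓝 (f x))) → (∀ n, p (F n)) → p f

section BoundedMeasurable

variable {α : Type*} [MeasurableSpace α] {f g : α → ℂ}

theorem BoundedMeasurable.add (hf : BoundedMeasurable f) (hg : BoundedMeasurable g) :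
    BoundedMeasurable (f + g) := by
  obtain ⟨⟨C, hC⟩, ⟨D, hD⟩⟩ := And.intro hf.bounded hg.bounded
  exact ⟨hf.measurable.add hg.measurable, C + D, fun x => (norm_add_le _ _).trans
    (add_le_add (hC x) (hD x))⟩

theorem BoundedMeasurable.smul (c : ℂ) (hf : BoundedMeasurable f) :
    BoundedMeasurable (c • f) := by
  obtain ⟨C, hC⟩ := hf.bounded
  exact ⟨hf.measurable.const_smul c, ‖c‖ * C, fun x => (norm_smul_le _ _).trans
    (mul_le_mul_of_nonneg_left (hC x) (norm_nonneg c))⟩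

theorem BoundedMeasurable.mul (hf : BoundedMeasurable f) (hg : BoundedMeasurable g) :
    BoundedMeasurable (f * g) := by
  obtain ⟨⟨C, hC⟩, ⟨D, hD⟩⟩ := And.intro hf.bounded hg.bounded
  exact ⟨hf.measurable.mul hg.measurable, C * D, fun x => (norm_mul_le _ _).trans
    (mul_le_mul (hC x) (hD x) (norm_nonneg _) ((norm_nonneg _).trans (hC x)))⟩

theorem BoundedMeasurable.star (hf : BoundedMeasurable f) : BoundedMeasurable (star f) := by
  obtain ⟨C, hC⟩ := hf.bounded
  exact ⟨Complex.continuous_conj.measurable.comp hf.measurable, C, fun x => by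
    simpa using hC x⟩

theorem boundedMeasurable_indicator {X : Set α} (hX : MeasurableSet X) :
    BoundedMeasurable (X.indicator (1 : α → ℂ)) :=
  ⟨measurable_one.indicator hX, 1, fun x => by
    by_cases h : x ∈ X <;> simp [h]⟩

theorem boundedMeasurable_one : BoundedMeasurable (1 : α → ℂ) :=
  ⟨measurable_one, 1, fun x => by simp⟩

theorem BoundedMeasurable.integrable (hf : BoundedMeasurable f) (μ : Measure α)
    [IsFiniteMeasure μ] : Integrable f μ := by
  obtain ⟨C, hC⟩ := hf.bounded
  exact Integrable.of_bound hf.measurable.aestronglyMeasurable C (ae_of_all _ hC)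

theorem ZeroAtInftyContinuousMap.boundedMeasurable [TopologicalSpace α] [OpensMeasurableSpace α]
    (f : C₀(α, ℂ)) : BoundedMeasurable f :=
  ⟨f.measurable, ‖f‖, f.norm_apply_le⟩

theorem ContinuousMap.boundedMeasurable [TopologicalSpace α] [CompactSpace α]
    [OpensMeasurableSpace α] (f : C(α, ℂ)) : BoundedMeasurable f :=
  ⟨f.continuous.measurable, ‖f‖, f.norm_coe_le_norm⟩

/-- Simple functions are combinations of indicators, and a bounded measurable function is a bounded
pointwise limit of simple functions. -/
theorem BoundedClosed.forall_of_indicator {p : (α → ℂ) → Prop} (hp : BoundedClosed p)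
    (hind : ∀ X : Set α, MeasurableSet X → p (X.indicator 1)) (hf : BoundedMeasurable f) :
    p f := by
  have hsimple : ∀ s : SimpleFunc α ℂ, p s := by
    intro s
    induction s using SimpleFunc.induction with
    | @const c s hs =>
      have := hp.smul c _ (boundedMeasurable_indicator hs) (hind s hs)
      convert this using 1
      ext x
      by_cases h : x ∈ s <;> simp [h]
    | @add f g hd hf hg =>
      have hb : ∀ s : SimpleFunc α ℂ, BoundedMeasurable s := fun s =>
        ⟨s.measurable, s.exists_forall_norm_le⟩
      exact hp.add _ _ (hb f) (hb g) hf hg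
  obtain ⟨C, hC⟩ := hf.bounded
  have hsm := hf.measurable.stronglyMeasurable
  rcases isEmpty_or_nonempty α with hα | ⟨⟨x₀⟩⟩
  · have : f = (0 : SimpleFunc α ℂ) := funext fun x => hα.elim x
    rw [this]
    exact hsimple 0
  have hC0 : 0 ≤ C := (norm_nonneg _).trans (hC x₀)
  exact hp.lim (fun n => hsm.approxBounded C n) f C (fun n => (hsm.approxBounded C n).measurable)
    (fun n x => hsm.norm_approxBounded_le hC0 n x) hf
    (fun x => hsm.tendsto_approxBounded_of_norm_le (hC x)) fun n => hsimple _

/-- Indicators of open sets are bounded limits of C₀ functions; Dynkin's π-λ theorem passes from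
open sets to Borel sets. -/
theorem BoundedClosed.forall_of_zeroAtInfty {Ω : Type*} [TopologicalSpace Ω] [T2Space Ω]
    [LocallyCompactSpace Ω] [SecondCountableTopology Ω] [MeasurableSpace Ω] [BorelSpace Ω]
    {p : (Ω → ℂ) → Prop} (hp : BoundedClosed p) (hC0 : ∀ f : C₀(Ω, ℂ), p f)
    {f : Ω → ℂ} (hf : BoundedMeasurable f) : p f := by
  refine hp.forall_of_indicator (fun X hX => ?_) hf
  have hopen : ∀ U : Set Ω, IsOpen U → p (U.indicator 1) := by
    intro U hU
    obtain ⟨f, hf, hlim⟩ := hU.exists_zeroAtInfty_tendsto_indicator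
    exact hp.lim (fun n => f n) _ 1 (fun n => (f n).measurable) hf
      (boundedMeasurable_indicator hU.measurableSet) hlim fun n => hC0 _
  have hgen : ‹MeasurableSpace Ω› = MeasurableSpace.generateFrom {s | IsOpen s} :=
    BorelSpace.measurable_eq
  induction X, hX using MeasurableSpace.induction_on_inter hgen isPiSystem_isOpen with
  | empty => exact hopen ∅ isOpen_empty
  | basic U hU => exact hopen U hU
  | compl X hX ih =>
    have h := hp.add _ _ (boundedMeasurable_indicator MeasurableSet.univ)
      ((boundedMeasurable_indicator hX).smul (-1)) (hopen _ isOpen_univ)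
      (hp.smul (-1) _ (boundedMeasurable_indicator hX) ih)
    convert h using 1
    ext x
    by_cases hx : x ∈ X <;> simp [hx]
  | iUnion X hd hX ih =>
    have hm : ∀ n : ℕ, MeasurableSet (⋃ i ∈ Finset.range n, X i) := fun n =>
      Finset.measurableSet_biUnion _ fun i _ => hX i
    refine hp.lim (fun n => (⋃ i ∈ Finset.range n, X i).indicator 1) _ 1
      (fun n => (boundedMeasurable_indicator (hm n)).measurable) (fun n x => ?_)
      (boundedMeasurable_indicator (MeasurableSet.iUnion hX)) (fun x => ?_) (fun n => ?_)
    · by_cases h : x ∈ ⋃ i ∈ Finset.range n, X i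
      · rw [Set.indicator_of_mem h]; simp
      · rw [Set.indicator_of_notMem h]; simp
    · exact ((tendsto_indicator_biUnion_finset X (1 : Ω → ℂ) x).mono_right
        (pure_le_nhds _)).comp tendsto_finset_range
    · induction n with
      | zero => simpa using hopen ∅ isOpen_empty
      | succ n ihn =>
        have hdis : Disjoint (X n) (⋃ i ∈ Finset.range n, X i) := by
          rw [Set.disjoint_iUnion₂_right]
          intro i hi
          exact hd (Finset.mem_range.1 hi).ne'
        rw [Finset.range_add_one, Finset.set_biUnion_insert,
          Set.indicator_union_of_disjoint hdis]
        exact hp.add _ _ (boundedMeasurable_indicator (hX n))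
          (boundedMeasurable_indicator (hm n)) (ih n) ihn

end BoundedMeasurable

theorem ContinuousLinearMap.isPositive_of_inner_nonneg {H : Type*} [NormedAddCommGroup H]
    [InnerProductSpace ℂ H] [CompleteSpace H] {A : H →L[ℂ] H} (h : ∀ ψ, 0 ≤ ⟪ψ, A ψ⟫_ℂ) :
    A.IsPositive := by
  rw [ContinuousLinearMap.isPositive_iff_complex]
  intro ψ
  rw [← inner_conj_symm]
  obtain ⟨h1, h2⟩ := Complex.nonneg_iff.1 (h ψ)
  generalize ⟪ψ, A ψ⟫_ℂ = z at h1 h2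
  exact ⟨Complex.ext (by simp) (by simp [← h2]), by simpa using h1⟩

/-! ### Operator integrals against a POVM -/

namespace POVM

variable {α : Type*} [MeasurableSpace α] {H : Type*} [NormedAddCommGroup H]
  [InnerProductSpace ℂ H] [CompleteSpace H]

theorem inner_self_apply (E : POVM α H) (ψ : H) {X : Set α} (hX : MeasurableSet X) :
    ⟪ψ, E X ψ⟫_ℂ = (((E.scalarMeasure ψ).real X : ℝ) : ℂ) := by
  have h := (E.isPositive X).inner_nonneg_right ψ
  rw [Measure.real, scalarMeasure_apply _ _ hX,
    ENNReal.toReal_ofReal (Complex.nonneg_iff.1 h).1]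
  exact Complex.ext rfl (by simpa using (Complex.nonneg_iff.1 h).2.symm)

theorem ext_of_scalarMeasure {E F : POVM α H} (h : ∀ ψ, E.scalarMeasure ψ = F.scalarMeasure ψ) :
    E = F := by
  have hEF : E.toFun = F.toFun := by
    funext X
    by_cases hX : MeasurableSet X
    · refine ContinuousLinearMap.ext_of_inner_self fun ψ => ?_
      rw [inner_self_apply E ψ hX, inner_self_apply F ψ hX, h]
    · rw [E.not_measurable' X hX, F.not_measurable' X hX]
  cases E; cases F; cases hEF; rfl

/-- A family of measures that comes from bounded operators defines a POVM. -/
theorem exists_of_scalarMeasures (μ : H → Measure α) [∀ ψ, IsFiniteMeasure (μ ψ)]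
    (huniv : ∀ ψ, (μ ψ).real Set.univ = ‖ψ‖ ^ 2)
    (hop : ∀ X, MeasurableSet X → ∃ A : H →L[ℂ] H, ∀ ψ, ⟪ψ, A ψ⟫_ℂ = (((μ ψ).real X : ℝ) : ℂ)) :
    ∃ P : POVM α H, ∀ ψ, P.scalarMeasure ψ = μ ψ := by
  classical
  choose! A hA using hop
  let P : POVM α H :=
    { toFun := fun X => if MeasurableSet X then A X else 0
      not_measurable' := fun X hX => if_neg hX
      isPositive' := fun X hX => by
        rw [if_pos hX]
        refine ContinuousLinearMap.isPositive_of_inner_nonneg fun ψ => ?_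
        rw [hA X hX]
        exact_mod_cast measureReal_nonneg
      univ' := by
        rw [if_pos MeasurableSet.univ]
        refine ContinuousLinearMap.ext_of_inner_self fun ψ => ?_
        rw [hA _ MeasurableSet.univ, huniv, one_apply_eq_self, inner_self_eq_norm_sq_to_K]
        simp
      empty' := by
        rw [if_pos MeasurableSet.empty]
        refine ContinuousLinearMap.ext_of_inner_self fun ψ => ?_
        rw [hA _ MeasurableSet.empty]
        simp
      hasSum' := by
        intro X hX hd φ ψ
        simp only [if_pos (hX _), if_pos (MeasurableSet.iUnion hX)]
        have hself : ∀ ψ, Tendsto (fun s : Finset ℕ => ⟪ψ, (∑ i ∈ s, A (X i)) ψ⟫_ℂ) atTop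
            (𝓝 ⟪ψ, A (⋃ i, X i) ψ⟫_ℂ) := by
          intro ψ
          have h : HasSum (fun i => (μ ψ).real (X i)) ((μ ψ).real (⋃ i, X i)) := by
            simp only [measureReal_def]
            rw [measure_iUnion hd hX, ENNReal.tsum_toReal_eq fun i => measure_ne_top _ _]
            refine (ENNReal.summable_toReal ?_).hasSum
            rw [← measure_iUnion hd hX]
            exact measure_ne_top _ _
          rw [hA _ (MeasurableSet.iUnion hX)]
          refine Tendsto.congr (fun s => ?_) (Complex.hasSum_ofReal.2 h)
          rw [sum_apply, inner_sum]
          exact Finset.sum_congr rfl fun i _ => (hA _ (hX i) ψ).symm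
        have := ContinuousLinearMap.tendsto_inner_of_tendsto_inner_self' hself φ ψ
        refine Tendsto.congr (fun s => ?_) this
        rw [sum_apply, inner_sum] }
  refine ⟨P, fun ψ => Measure.ext fun X hX => ?_⟩
  rw [scalarMeasure_apply _ _ hX]
  change ENNReal.ofReal (⟪ψ, (if MeasurableSet X then A X else 0) ψ⟫_ℂ).re = _
  rw [if_pos hX, hA X hX, Complex.ofReal_re, ofReal_measureReal]

section Integral

variable (E : POVM α H) {f g h : α → ℂ}

theorem isIntegral_of_boundedMeasurable (hf : BoundedMeasurable f) :
    E.IsIntegral f (E.integral f) := by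
  obtain ⟨C, hC⟩ := hf.bounded
  exact E.isIntegral_integral hf.measurable hC

theorem inner_integral (hf : BoundedMeasurable f) (ψ : H) :
    ⟪ψ, E.integral f ψ⟫_ℂ = ∫ x, f x ∂(E.scalarMeasure ψ) :=
  (E.isIntegral_of_boundedMeasurable hf ψ).2

theorem integral_eq_of_inner (hf : BoundedMeasurable f) {A : H →L[ℂ] H}
    (h : ∀ ψ, ⟪ψ, A ψ⟫_ℂ = ∫ x, f x ∂(E.scalarMeasure ψ)) : E.integral f = A :=
  ContinuousLinearMap.ext_of_inner_self fun ψ => (E.inner_integral hf ψ).trans (h ψ).symm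

theorem integral_add (hf : BoundedMeasurable f) (hg : BoundedMeasurable g) :
    E.integral (f + g) = E.integral f + E.integral g := by
  refine E.integral_eq_of_inner (hf.add hg) fun ψ => ?_
  rw [add_apply, inner_add_right, E.inner_integral hf, E.inner_integral hg]
  exact (MeasureTheory.integral_add (hf.integrable _) (hg.integrable _)).symm

theorem integral_smul (c : ℂ) (hf : BoundedMeasurable f) :
    E.integral (c • f) = c • E.integral f := by
  refine E.integral_eq_of_inner (hf.smul c) fun ψ => ?_
  rw [smul_apply, inner_smul_right, E.inner_integral hf]
  exact (MeasureTheory.integral_smul c f).symm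

theorem integral_indicator {X : Set α} (hX : MeasurableSet X) :
    E.integral (X.indicator 1) = E X := by
  refine E.integral_eq_of_inner (boundedMeasurable_indicator hX) fun ψ => ?_
  rw [integral_indicator_one_complex _ hX, E.inner_self_apply ψ hX]

theorem integral_one : E.integral 1 = 1 := by
  rw [← E.univ', ← E.integral_indicator MeasurableSet.univ, Set.indicator_univ]

theorem integral_star (hf : BoundedMeasurable f) :
    E.integral (star f) = star (E.integral f) := by
  refine E.integral_eq_of_inner hf.star fun ψ => ?_
  rw [ContinuousLinearMap.star_eq_adjoint, ContinuousLinearMap.adjoint_inner_right,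
    ← inner_conj_symm, E.inner_integral hf, ← integral_conj]
  rfl

theorem isPositive_integral (hf : BoundedMeasurable f) (h0 : ∀ x, 0 ≤ f x) :
    (E.integral f).IsPositive := by
  refine ContinuousLinearMap.isPositive_of_inner_nonneg fun ψ => ?_
  rw [E.inner_integral hf]
  exact integral_nonneg h0

theorem tendsto_inner_integral {F : ℕ → α → ℂ} {C : ℝ} (hF : ∀ n, Measurable (F n))
    (hC : ∀ n x, ‖F n x‖ ≤ C) (hf : BoundedMeasurable f)
    (hlim : ∀ x, Tendsto (fun n => F n x) atTop (𝓝 (f x))) (φ ψ : H) :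
    Tendsto (fun n => ⟪φ, E.integral (F n) ψ⟫_ℂ) atTop (𝓝 ⟪φ, E.integral f ψ⟫_ℂ) := by
  refine ContinuousLinearMap.tendsto_inner_of_tendsto_inner_self' (fun ψ => ?_) φ ψ
  rw [E.inner_integral hf]
  simp only [fun n => E.inner_integral ⟨hF n, C, hC n⟩ ψ]
  exact tendsto_integral_of_dominated_convergence (fun _ => C)
    (fun n => (hF n).aestronglyMeasurable) (integrable_const C) (fun n => ae_of_all _ (hC n))
    (ae_of_all _ hlim)

/-- Identities between operators that depend on `f` through `E(f h)` pass to limits. -/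
theorem boundedClosed_mul_integral_mul (hg : BoundedMeasurable g) (hh : BoundedMeasurable h)
    (A B A' B' : H →L[ℂ] H) :
    BoundedClosed fun f => A * E.integral (f * g) * B = A' * E.integral (f * h) * B' where
  add f₁ f₂ h₁ h₂ e₁ e₂ := by
    rw [add_mul, add_mul, E.integral_add (h₁.mul hg) (h₂.mul hg),
      E.integral_add (h₁.mul hh) (h₂.mul hh), mul_add, mul_add, add_mul, add_mul, e₁, e₂]
  smul c f hf e := by
    rw [smul_mul_assoc, smul_mul_assoc, E.integral_smul c (hf.mul hg),
      E.integral_smul c (hf.mul hh), mul_smul_comm, mul_smul_comm, smul_mul_assoc, smul_mul_assoc,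
      e]
  lim F f C hF hC hf hlim e := by
    have key : ∀ {k : α → ℂ}, BoundedMeasurable k → ∀ (S T : H →L[ℂ] H) (φ ψ : H),
        Tendsto (fun n => ⟪φ, (S * E.integral (F n * k) * T) ψ⟫_ℂ) atTop
          (𝓝 ⟪φ, (S * E.integral (f * k) * T) ψ⟫_ℂ) := by
      intro k hk S T φ ψ
      obtain ⟨D, hD⟩ := hk.bounded
      change Tendsto (fun n => ⟪φ, S (E.integral (F n * k) (T ψ))⟫_ℂ) atTop
        (𝓝 ⟪φ, S (E.integral (f * k) (T ψ))⟫_ℂ)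
      -- With S moved to the left slot as its adjoint, only weak convergence of the integrals is
      -- needed.
      simp only [← ContinuousLinearMap.adjoint_inner_left S]
      refine E.tendsto_inner_integral (C := C * D) (fun n => (hF n).mul hk.measurable)
        (fun n x => ?_) (hf.mul hk) (fun x => (hlim x).mul_const (k x)) _ _
      exact (norm_mul_le _ _).trans
        (mul_le_mul (hC n x) (hD x) (norm_nonneg _) ((norm_nonneg _).trans (hC n x)))
    refine ContinuousLinearMap.ext fun ψ => ext_inner_left ℂ fun φ => ?_
    exact tendsto_nhds_unique (key hg A B φ ψ) ((key hh A' B' φ ψ).congr fun n => by rw [e n])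

theorem commute_integral {T : H →L[ℂ] H} (hT : ∀ X, MeasurableSet X → T * E X = E X * T)
    (hf : BoundedMeasurable f) : T * E.integral f = E.integral f * T := by
  have := (E.boundedClosed_mul_integral_mul boundedMeasurable_one boundedMeasurable_one
    T 1 1 T).forall_of_indicator (fun X hX => ?_) hf
  · simpa using this
  · simpa [E.integral_indicator hX] using hT X hX

variable {E}

/-- The operators `E(f)` of a commutative observable commute with each other. -/
theorem IsCommutative.commute_integral [TopologicalSpace α] [OpensMeasurableSpace α]
    (hE : E.IsCommutative) (f g : C₀(α, ℂ)) :
    E.integral f * E.integral g = E.integral g * E.integral f :=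
  E.commute_integral (fun X hX => hE X hX _ ⟨f, rfl⟩) g.boundedMeasurable

/-- Sharpness is multiplicativity on indicators. It is extended one factor at a time, keeping the
other fixed, because weak limits are only separately compatible with products. -/
theorem IsSharp.integral_mul (hE : E.IsSharp) (hf : BoundedMeasurable f)
    (hg : BoundedMeasurable g) : E.integral (f * g) = E.integral f * E.integral g := by
  have h1 : ∀ Y, MeasurableSet Y → ∀ {f}, BoundedMeasurable f →
      E.integral (f * Y.indicator 1) = E.integral f * E Y := by
    intro Y hY f hf
    have := (E.boundedClosed_mul_integral_mul (boundedMeasurable_indicator hY)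
      boundedMeasurable_one 1 1 1 (E Y)).forall_of_indicator (fun X hX => ?_) hf
    · simpa using this
    · have : X.indicator (1 : α → ℂ) * Y.indicator 1 = (X ∩ Y).indicator 1 := by
        rw [Set.inter_indicator_one]
      simp only [this, one_mul, mul_one, E.integral_indicator (hX.inter hY),
        E.integral_indicator hX, hE X Y hX hY]
  have := (E.boundedClosed_mul_integral_mul hf
      boundedMeasurable_one 1 1 (E.integral f) 1).forall_of_indicator (fun X hX => ?_) hg
  · simpa [mul_comm f g] using this
  · simpa [E.integral_indicator hX, mul_comm f] using h1 X hX hf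

/-- The functional calculus of a sharp observable on a compact space. -/
def IsSharp.starAlgHom [TopologicalSpace α] [CompactSpace α] [OpensMeasurableSpace α]
    (hE : E.IsSharp) : C(α, ℂ) →⋆ₐ[ℂ] (H →L[ℂ] H) where
  toFun f := E.integral f
  map_one' := E.integral_one
  map_mul' f g := hE.integral_mul f.boundedMeasurable g.boundedMeasurable
  map_zero' := by
    have := E.integral_smul 0 (f := 1) boundedMeasurable_one
    rw [zero_smul, zero_smul] at this
    exact this
  map_add' f g := E.integral_add f.boundedMeasurable g.boundedMeasurable
  commutes' c := by
    have := E.integral_smul c (f := 1) boundedMeasurable_one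
    rw [E.integral_one] at this
    rw [Algebra.algebraMap_eq_smul_one, Algebra.algebraMap_eq_smul_one]
    exact this
  map_star' f := E.integral_star f.boundedMeasurable

@[simp]
theorem IsSharp.starAlgHom_apply [TopologicalSpace α] [CompactSpace α] [OpensMeasurableSpace α]
    (hE : E.IsSharp) (f : C(α, ℂ)) : hE.starAlgHom f = E.integral f := rfl

end Integral

/-! ### Spectral theorem for C(K) with K compact and second countable -/

section Spectral

variable {K : Type*} [TopologicalSpace K] [CompactSpace K] [T2Space K] [SecondCountableTopology K]
  [MeasurableSpace K] [BorelSpace K]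

/-- Star homomorphisms preserve positivity, so f ↦ ⟨ψ, π(f) ψ⟩ is a positive functional of mass at
most ‖ψ‖², and Riesz representation applies. -/
theorem exists_scalarMeasure_of_starAlgHom (π : C(K, ℂ) →⋆ₐ[ℂ] (H →L[ℂ] H)) (ψ : H) :
    ∃ μ : Measure K, IsFiniteMeasure μ ∧ ∀ f : C(K, ℂ), ⟪ψ, π f ψ⟫_ℂ = ∫ x, f x ∂μ := by
  let Λ : C₀(K, ℂ) →ₗ[ℂ] ℂ :=
    { toFun := fun f => ⟪ψ, π f.toContinuousMap ψ⟫_ℂ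
      map_add' := fun f g => by
        rw [← inner_add_right, ← add_apply, ← map_add]
        rfl
      map_smul' := fun c f => by
        rw [RingHom.id_apply, smul_eq_mul, ← inner_smul_right, ← smul_apply, ← map_smul]
        rfl }
  have hpos : ∀ f : C(K, ℂ), (∀ x, 0 ≤ f x) → 0 ≤ ⟪ψ, π f ψ⟫_ℂ := by
    intro f hf
    have h : 0 ≤ π f := map_nonneg π (ContinuousMap.le_def.2 hf)
    exact ((ContinuousLinearMap.nonneg_iff_isPositive _).1 h).inner_nonneg_right ψ
  have hle : ∀ f : C₀(K, ℂ), (∀ x, 0 ≤ f x) → (∀ x, f x ≤ 1) → Λ f ≤ (‖ψ‖ ^ 2 : ℝ) := by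
    intro f _ hf1
    have := hpos (1 - f.toContinuousMap) fun x => sub_nonneg.2 (hf1 x)
    rw [map_sub, map_one, sub_apply, inner_sub_right, one_apply_eq_self,
      inner_self_eq_norm_sq_to_K, sub_nonneg] at this
    change ⟪ψ, π f.toContinuousMap ψ⟫_ℂ ≤ _
    simpa using this
  obtain ⟨μ, hμ, h⟩ := exists_measure_of_positive_functional Λ
    (fun f hf => hpos f.toContinuousMap hf) hle
  exact ⟨μ, ⟨hμ.trans_lt ENNReal.ofReal_lt_top⟩, fun f => h ⟨f, by simp⟩⟩

/-- **Spectral theorem** for representations of the continuous functions on a compact metrizable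
space. -/
theorem exists_isSharp_of_starAlgHom (π : C(K, ℂ) →⋆ₐ[ℂ] (H →L[ℂ] H)) :
    ∃ P : POVM K H, P.IsSharp ∧ ∀ f : C(K, ℂ), P.integral f = π f := by
  choose μ hfin hμ using exists_scalarMeasure_of_starAlgHom π
  -- The functions f for which ψ ↦ ∫ f dμ_ψ is the quadratic form of a bounded operator include C(K)
  -- and are closed under bounded limits, so they include all Borel indicators.
  have hclosed : BoundedClosed fun f : K → ℂ =>
      ∃ A : H →L[ℂ] H, ∀ ψ, ⟪ψ, A ψ⟫_ℂ = ∫ x, f x ∂μ ψ := by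
    refine ⟨?_, ?_, ?_⟩
    · rintro f g hf hg ⟨A, hA⟩ ⟨B, hB⟩
      refine ⟨A + B, fun ψ => ?_⟩
      rw [add_apply, inner_add_right, hA, hB]
      exact (MeasureTheory.integral_add (hf.integrable _) (hg.integrable _)).symm
    · rintro c f hf ⟨A, hA⟩
      refine ⟨c • A, fun ψ => ?_⟩
      rw [smul_apply, inner_smul_right, hA]
      exact (MeasureTheory.integral_smul c f).symm
    · intro F f C hF hC hf hlim h
      choose A hA using h
      refine ContinuousLinearMap.exists_of_tendsto_inner_self (A := A) fun ψ => ?_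
      simp only [hA]
      exact tendsto_integral_of_dominated_convergence (fun _ => C)
        (fun n => (hF n).aestronglyMeasurable) (integrable_const C)
        (fun n => ae_of_all _ (hC n)) (ae_of_all _ hlim)
  obtain ⟨P, hP⟩ := exists_of_scalarMeasures μ (fun ψ => by
      have := hμ ψ 1
      rw [map_one, one_apply_eq_self, inner_self_eq_norm_sq_to_K] at this
      simp only [ContinuousMap.one_apply, integral_const, Complex.real_smul, mul_one] at this
      exact Complex.ofReal_injective (by simpa using this.symm)) (fun X hX => by
      obtain ⟨A, hA⟩ := hclosed.forall_of_zeroAtInfty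
        (fun f => ⟨π f.toContinuousMap, fun ψ => hμ ψ f.toContinuousMap⟩)
        (boundedMeasurable_indicator hX)
      exact ⟨A, fun ψ => by rw [hA, integral_indicator_one_complex _ hX]⟩)
  have hintegral : ∀ f : C(K, ℂ), P.integral f = π f := fun f =>
    P.integral_eq_of_inner f.boundedMeasurable fun ψ => by rw [hP, hμ]
  -- Multiplicativity of π on C(K) is extended first to a bounded Borel first factor, then, with
  -- that factor an indicator, to a second indicator.
  have hmul : ∀ f : C(K, ℂ), ∀ {g : K → ℂ}, BoundedMeasurable g →
      P.integral (g * f) = P.integral g * P.integral f := by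
    intro f g hg
    have := (P.boundedClosed_mul_integral_mul f.boundedMeasurable boundedMeasurable_one
      1 1 1 (P.integral f)).forall_of_zeroAtInfty (fun g => ?_) hg
    · simpa using this
    · have e := hintegral (g.toContinuousMap * f)
      rw [map_mul, ← hintegral, ← hintegral] at e
      simpa using e
  refine ⟨P, fun X Y hX hY => ?_, hintegral⟩
  have := (P.boundedClosed_mul_integral_mul (boundedMeasurable_indicator hX)
      boundedMeasurable_one 1 1 (P X) 1).forall_of_zeroAtInfty (fun g => ?_)
      (boundedMeasurable_indicator hY)
  · rw [← Set.inter_indicator_one, Set.inter_comm] at this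
    simpa [P.integral_indicator, hX, hY, hX.inter hY] using this
  · have e := hmul g.toContinuousMap (boundedMeasurable_indicator hX)
    rw [mul_comm, P.integral_indicator hX] at e
    simpa using e

end Spectral

end POVM

/-- A closed commutative star subalgebra of a C⋆-algebra is a commutative C⋆-algebra. -/
abbrev StarSubalgebra.commCStarAlgebraOfComm {A : Type*} [CStarAlgebra A] (S : StarSubalgebra ℂ A)
    [h_closed : IsClosed (S : Set A)] (hS : ∀ x y : S, x * y = y * x) : CommCStarAlgebra S where
  toCompleteSpace := h_closed.completeSpace_coe
  norm_mul_self_le x := CStarRing.norm_star_mul_self (x := (x : A)) |>.symm.le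
  mul_comm := hS

/-! ### The representing PVM: existence, uniqueness, support and commutant -/

section Representation

variable {Ω : Type*} [TopologicalSpace Ω] [T2Space Ω] [LocallyCompactSpace Ω]
  [SecondCountableTopology Ω] [MeasurableSpace Ω] [BorelSpace Ω]
  {H : Type*} [NormedAddCommGroup H] [InnerProductSpace ℂ H] [CompleteSpace H]

namespace SubprobabilityMeasure

theorem boundedMeasurable_integral {f : Ω → ℂ} (hf : BoundedMeasurable f) :
    BoundedMeasurable fun μ : SubprobabilityMeasure Ω => ∫ x, f x ∂μ.toMeasure := by
  obtain ⟨C, hC⟩ := hf.bounded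
  refine ⟨(hf.measurable.stronglyMeasurable.integral_kernel (κ := kernel Ω)).measurable, |C|,
    fun μ => μ.norm_integral_le (abs_nonneg C) fun x => (hC x).trans (le_abs_self C)⟩

theorem integral_bind_toMeasure (m : Measure (SubprobabilityMeasure Ω)) [IsFiniteMeasure m]
    {f : Ω → ℂ} (hf : BoundedMeasurable f) :
    ∫ x, f x ∂(m.bind toMeasure) = ∫ μ, ∫ x, f x ∂μ.toMeasure ∂m := by
  have hintegral : Integrable f (m.bind (kernel Ω)) := hf.integrable _
  change ∫ x, f x ∂(m.bind (kernel Ω)) = _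
  -- Viewing m as a constant kernel turns the mixture into a composition of kernels, where the
  -- iterated integral formula is available.
  rw [Measure.comp_eq_comp_const_apply] at hintegral ⊢
  rw [ProbabilityTheory.Kernel.integral_comp hintegral]
  simp

instance (m : Measure (SubprobabilityMeasure Ω)) [IsFiniteMeasure m] :
    IsFiniteMeasure (m.bind toMeasure) :=
  inferInstanceAs (IsFiniteMeasure (m.bind (kernel Ω)))

/-- The functions `μ ↦ μ(f)` generate the continuous functions on `B(Ω)⁺`. -/
theorem topologicalClosure_adjoin_range_evalMap :
    (StarAlgebra.adjoin ℂ (Set.range (evalMap (Ω := Ω)))).topologicalClosure = ⊤ := by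
  refine ContinuousMap.starSubalgebra_topologicalClosure_eq_top_of_separatesPoints _ ?_
  intro μ ν hμν
  by_contra! h
  refine hμν (ext_of_integral_eq fun f => ?_)
  exact h (evalMap f) ⟨evalMap f, StarAlgebra.subset_adjoin ℂ _ ⟨f, rfl⟩, rfl⟩

end SubprobabilityMeasure

open SubprobabilityMeasure

namespace POVM

variable {P Q : POVM (SubprobabilityMeasure Ω) H} {E : POVM Ω H}

/-- Testing on C₀(Ω) determines finite measures, so the operator identity becomes an identity
between scalar measures. `representsOnSets_iff` reaches the same identity by testing on Borel sets,
which makes (1) and (2) equivalent. -/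
theorem representsOnFunctions_iff : P.RepresentsOnFunctions E ↔
    ∀ ψ, E.scalarMeasure ψ = (P.scalarMeasure ψ).bind toMeasure := by
  refine ⟨fun h ψ => Measure.ext_of_forall_integral_zeroAtInfty fun f => ?_, fun h f => ?_⟩
  · rw [integral_bind_toMeasure _ f.boundedMeasurable, ← E.inner_integral f.boundedMeasurable,
      h f, P.inner_integral (boundedMeasurable_integral f.boundedMeasurable)]
  · refine E.integral_eq_of_inner f.boundedMeasurable fun ψ => ?_
    rw [h, integral_bind_toMeasure _ f.boundedMeasurable,
      P.inner_integral (boundedMeasurable_integral f.boundedMeasurable)]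

theorem representsOnSets_iff : P.RepresentsOnSets E ↔
    ∀ ψ, E.scalarMeasure ψ = (P.scalarMeasure ψ).bind toMeasure := by
  have hb : ∀ X : Set Ω, MeasurableSet X → BoundedMeasurable
      fun μ : SubprobabilityMeasure Ω => ((μ.toMeasure.real X : ℝ) : ℂ) := fun X hX => by
    simpa only [integral_indicator_one_complex _ hX] using
      boundedMeasurable_integral (boundedMeasurable_indicator hX)
  have key : ∀ X : Set Ω, MeasurableSet X → ∀ ψ,
      ((((P.scalarMeasure ψ).bind toMeasure).real X : ℝ) : ℂ) =
        ∫ μ : SubprobabilityMeasure Ω, ((μ.toMeasure.real X : ℝ) : ℂ) ∂P.scalarMeasure ψ := by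
    intro X hX ψ
    rw [← integral_indicator_one_complex _ hX,
      integral_bind_toMeasure _ (boundedMeasurable_indicator hX)]
    simp only [integral_indicator_one_complex _ hX]
  refine ⟨fun h ψ => Measure.ext fun X hX => ?_, fun h X hX => ?_⟩
  · rw [← measureReal_eq_measureReal_iff]
    apply Complex.ofReal_injective
    rw [← E.inner_self_apply ψ hX, h X hX, P.inner_integral (hb X hX), key X hX]
  · refine (P.integral_eq_of_inner (hb X hX) fun ψ => ?_).symm
    rw [E.inner_self_apply ψ hX, h, key X hX]

theorem RepresentsOnFunctions.apply_compl_probabilityMeasures (h : P.RepresentsOnFunctions E) :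
    P (probabilityMeasures Ω)ᶜ = 0 := by
  have hm := (measurableSet_probabilityMeasures (Ω := Ω)).compl
  refine ContinuousLinearMap.ext_of_inner_self fun ψ => ?_
  rw [P.inner_self_apply ψ hm]
  have huniv : ∫⁻ μ : SubprobabilityMeasure Ω, μ.toMeasure Set.univ ∂P.scalarMeasure ψ =
      ∫⁻ _, 1 ∂P.scalarMeasure ψ := by
    rw [← Measure.bind_apply MeasurableSet.univ measurable_toMeasure.aemeasurable,
      ← representsOnFunctions_iff.1 h ψ, scalarMeasure_univ, lintegral_one, scalarMeasure_univ]
  -- The function μ ↦ μ(Ω) is at most 1 and has the same finite integral as 1, hence equals 1 almost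
  -- everywhere.
  have hae := ae_eq_of_ae_le_of_lintegral_le
    (ae_of_all (P.scalarMeasure ψ) fun μ : SubprobabilityMeasure Ω => μ.measure_univ_le_one)
    (by
      rw [huniv, lintegral_one]
      exact measure_ne_top _ _) aemeasurable_const huniv.ge
  have : P.scalarMeasure ψ (probabilityMeasures Ω)ᶜ = 0 := hae
  simp [measureReal_def, this]

/-- Two star homomorphisms on C(B(Ω)⁺) are automatically continuous and agree on a closed star
subalgebra; it contains the functions μ ↦ μ(f), so it is everything by Stone–Weierstrass. -/
theorem IsSharp.eq_of_representsOnFunctions (hP : P.IsSharp) (hQ : Q.IsSharp)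
    (hPE : P.RepresentsOnFunctions E) (hQE : Q.RepresentsOnFunctions E) : P = Q := by
  have hle : (⊤ : StarSubalgebra ℂ C(SubprobabilityMeasure Ω, ℂ)) ≤
      StarAlgHom.equalizer hP.starAlgHom hQ.starAlgHom := by
    rw [← topologicalClosure_adjoin_range_evalMap]
    refine StarSubalgebra.topologicalClosure_minimal (StarAlgebra.adjoin_le ?_) ?_
    · rintro _ ⟨f, rfl⟩
      exact (hPE f).symm.trans (hQE f)
    · exact isClosed_eq (map_continuous hP.starAlgHom) (map_continuous hQ.starAlgHom)
  refine ext_of_scalarMeasure fun ψ => Measure.ext_of_forall_integral_zeroAtInfty fun f => ?_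
  have h : P.integral f = Q.integral f := hle (StarSubalgebra.mem_top (x := f.toContinuousMap))
  rw [← P.inner_integral f.boundedMeasurable, h, Q.inner_integral f.boundedMeasurable]

theorem IsSharp.commutant_eq (hP : P.IsSharp) (hPE : P.RepresentsOnFunctions E) :
    E.commutant = P.commutant := by
  refine Set.Subset.antisymm (fun T hT => ?_) (Set.centralizer_subset ?_)
  · have hcl : IsClosed {g | hP.starAlgHom g * T = T * hP.starAlgHom g} :=
      isClosed_eq ((map_continuous hP.starAlgHom).mul continuous_const)
        (continuous_const.mul (map_continuous hP.starAlgHom))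
    have hadj : ∀ g ∈ StarAlgebra.adjoin ℂ (Set.range (evalMap (Ω := Ω))),
        hP.starAlgHom g * T = T * hP.starAlgHom g := by
      -- T need not be normal, so its commutant is only an algebra. The star-closed generating set
      -- is handled explicitly: the conjugate of μ ↦ μ(f) is μ ↦ μ(f̄).
      have hle : Algebra.adjoin ℂ (Set.range (evalMap (Ω := Ω)) ∪ star (Set.range evalMap)) ≤
          (Subalgebra.centralizer ℂ {T}).comap hP.starAlgHom.toAlgHom := by
        refine Algebra.adjoin_le ?_
        have hmem : ∀ f : C₀(Ω, ℂ), hP.starAlgHom (evalMap f) * T =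
            T * hP.starAlgHom (evalMap f) := fun f => by
          rw [hP.starAlgHom_apply, coe_evalMap, ← hPE f]
          exact hT _ ⟨f, rfl⟩
        rintro g (⟨f, rfl⟩ | ⟨f, hf⟩)
        · exact (Subalgebra.mem_centralizer_iff ℂ).2 (by rintro _ rfl; exact (hmem f).symm)
        · have hg : g = evalMap (star f) := by
            rw [← star_star g, ← hf]
            ext μ
            exact (integral_conj (f := fun x => f x) (μ := μ.toMeasure)).symm
          rw [hg]
          exact (Subalgebra.mem_centralizer_iff ℂ).2 (by rintro _ rfl; exact (hmem _).symm)
      intro g hg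
      exact ((Subalgebra.mem_centralizer_iff ℂ).1 (hle hg) T rfl).symm
    rintro _ ⟨g, rfl⟩
    have hg : g.toContinuousMap ∈
        (StarAlgebra.adjoin ℂ (Set.range (evalMap (Ω := Ω)))).topologicalClosure := by
      rw [topologicalClosure_adjoin_range_evalMap]
      exact StarSubalgebra.mem_top
    exact hcl.closure_subset_iff.2 hadj hg
  · rintro _ ⟨f, rfl⟩
    exact ⟨⟨evalMap f, by simp⟩, (hPE f).symm⟩

/-- An observable whose operators lie in a commutative C⋆-algebra has a functional calculus on
`B(Ω)⁺`, since the characters of the algebra define measures on `Ω`. -/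
theorem exists_starAlgHom_of_commCStarAlgebra {A : Type*} [CommCStarAlgebra A]
    (ι : A →⋆ₐ[ℂ] (H →L[ℂ] H)) (hinj : Function.Injective ι)
    (hpos : ∀ (χ : WeakDual.characterSpace ℂ A) (b : A), (ι b).IsPositive → 0 ≤ χ b)
    (a : C₀(Ω, ℂ) → A) (ha : ∀ f : C₀(Ω, ℂ), ι (a f) = E.integral f) :
    ∃ π : C(SubprobabilityMeasure Ω, ℂ) →⋆ₐ[ℂ] (H →L[ℂ] H),
      ∀ f : C₀(Ω, ℂ), π (evalMap f) = E.integral f := by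
  have hadd : ∀ f g : C₀(Ω, ℂ), a (f + g) = a f + a g := fun f g => hinj <| by
    rw [map_add, ha, ha, ha]
    exact E.integral_add f.boundedMeasurable g.boundedMeasurable
  have hsmul : ∀ (c : ℂ) (f : C₀(Ω, ℂ)), a (c • f) = c • a f := fun c f => hinj <| by
    rw [map_smul, ha, ha]
    exact E.integral_smul c f.boundedMeasurable
  have hmeas : ∀ χ : WeakDual.characterSpace ℂ A, ∃ μ : SubprobabilityMeasure Ω,
      ∀ f : C₀(Ω, ℂ), χ (a f) = ∫ x, f x ∂μ.toMeasure := by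
    intro χ
    let Λ : C₀(Ω, ℂ) →ₗ[ℂ] ℂ :=
      { toFun := fun f => χ (a f)
        map_add' := fun f g => by rw [hadd, map_add]
        map_smul' := fun c f => by rw [hsmul, map_smul, RingHom.id_apply] }
    refine exists_of_positive_functional Λ (fun f hf => ?_) (fun f hf hf1 => ?_)
    · exact hpos χ (a f) (ha f ▸ E.isPositive_integral f.boundedMeasurable hf)
    · have hb : BoundedMeasurable (1 + (-1 : ℂ) • ⇑f) :=
        boundedMeasurable_one.add (f.boundedMeasurable.smul (-1))
      -- 1 - f need not vanish at infinity, but its integral still lies in the algebra because the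
      -- algebra is unital. Positivity of E(1 - f) then gives χ(a f) ≤ 1.
      have he : ι (1 - a f) = E.integral (1 + (-1 : ℂ) • ⇑f) := by
        rw [E.integral_add boundedMeasurable_one (f.boundedMeasurable.smul (-1)),
          E.integral_smul _ f.boundedMeasurable, E.integral_one, neg_one_smul, ← sub_eq_add_neg,
          map_sub, map_one, ha]
      have := hpos χ (1 - a f) (he ▸ E.isPositive_integral hb fun x => by
        simpa [← sub_eq_add_neg] using hf1 x)
      rw [map_sub, map_one, sub_nonneg] at this
      exact this
  choose m hm using hmeas
  have hmc : Continuous m := by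
    rw [isInducing_integral.continuous_iff, continuous_pi_iff]
    intro f
    simp only [Function.comp_apply, ← hm]
    exact (WeakDual.eval_continuous (a f)).comp continuous_subtype_val
  -- π is pullback along m, then the inverse Gelfand transform, then ι. Pulling back μ ↦ μ(f) gives
  -- χ ↦ χ(a f), the Gelfand transform of a f.
  refine ⟨(ι.comp ((gelfandStarTransform A).symm : _ →⋆ₐ[ℂ] A)).comp
    (ContinuousMap.compStarAlgHom' ℂ ℂ ⟨m, hmc⟩), fun f => ?_⟩
  have hf : ContinuousMap.compStarAlgHom' ℂ ℂ ⟨m, hmc⟩ (evalMap f) =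
      gelfandStarTransform A (a f) := by
    ext χ
    exact (hm χ f).symm
  rw [StarAlgHom.comp_apply, hf, StarAlgHom.comp_apply, ← ha f]
  exact congrArg ι ((gelfandStarTransform A).symm_apply_apply (a f))

theorem IsCommutative.exists_starAlgHom (hE : E.IsCommutative) :
    ∃ π : C(SubprobabilityMeasure Ω, ℂ) →⋆ₐ[ℂ] (H →L[ℂ] H),
      ∀ f : C₀(Ω, ℂ), π (evalMap f) = E.integral f := by
  let S : Set (H →L[ℂ] H) := Set.range fun f : C₀(Ω, ℂ) => E.integral f
  let A : StarSubalgebra ℂ (H →L[ℂ] H) := (StarAlgebra.adjoin ℂ S).topologicalClosure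
  have hcl : IsClosed (A : Set (H →L[ℂ] H)) := isClosed_closure
  have hadj : IsMulCommutative (StarAlgebra.adjoin ℂ S) := by
    refine StarAlgebra.isMulCommutative_adjoin ℂ ?_ ?_
    · rintro _ ⟨f, rfl⟩ _ ⟨g, rfl⟩
      exact hE.commute_integral f g
    · rintro _ ⟨f, rfl⟩ _ ⟨g, rfl⟩
      have hstar : star (E.integral g) = E.integral (star g : C₀(Ω, ℂ)) :=
        (E.integral_star g.boundedMeasurable).symm
      rw [hstar]
      exact hE.commute_integral f (star g)
  have hcomm : ∀ x y : A, x * y = y * x :=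
    (StarSubalgebra.commRingTopologicalClosure (StarAlgebra.adjoin ℂ S) mul_comm').mul_comm
  have hpos : ∀ χ : A →ₐ[ℂ] ℂ, ∀ b : A, (b : H →L[ℂ] H).IsPositive → 0 ≤ χ b := by
    intro χ b hb
    -- Spectral permanence: the spectrum of b in the closed star subalgebra A is its spectrum as an
    -- operator, which is nonnegative when b is positive.
    have h : χ b ∈ spectrum ℂ (b : H →L[ℂ] H) := by
      rw [← StarSubalgebra.spectrum_eq]
      exact AlgHom.apply_mem_spectrum χ b
    exact spectrum_nonneg_of_nonneg ((ContinuousLinearMap.nonneg_iff_isPositive _).2 hb) h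
  let : CommCStarAlgebra A := A.commCStarAlgebraOfComm hcomm
  exact exists_starAlgHom_of_commCStarAlgebra A.subtype Subtype.val_injective
    (fun χ b hb => hpos (WeakDual.CharacterSpace.toAlgHom χ) b hb)
    (fun f => ⟨E.integral f, (StarAlgebra.adjoin ℂ S).le_topologicalClosure
      (StarAlgebra.subset_adjoin ℂ S ⟨f, rfl⟩)⟩) fun f => rfl

theorem IsCommutative.exists_isSharp_representsOnFunctions (hE : E.IsCommutative) :
    ∃ P : POVM (SubprobabilityMeasure Ω) H, P.IsSharp ∧ P.RepresentsOnFunctions E := by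
  obtain ⟨π, hπ⟩ := hE.exists_starAlgHom
  obtain ⟨P, hP, hPπ⟩ := exists_isSharp_of_starAlgHom π
  exact ⟨P, hP, fun f => by rw [← hπ f, ← hPπ, coe_evalMap]⟩

end POVM

end Representation

end

theorem theorem2 {Ω : Type*} [TopologicalSpace Ω] [T2Space Ω] [LocallyCompactSpace Ω]
    [SecondCountableTopology Ω] [MeasurableSpace Ω] [BorelSpace Ω]
    {H : Type*} [NormedAddCommGroup H] [InnerProductSpace ℂ H] [CompleteSpace H]
    [TopologicalSpace.SeparableSpace H]
    (E : POVM Ω H) (hE : E.IsCommutative) :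
    (∃! P : POVM (SubprobabilityMeasure Ω) H, P.IsSharp ∧ P.RepresentsOnFunctions E) ∧
    (∀ P : POVM (SubprobabilityMeasure Ω) H, P.IsSharp →
      (P.RepresentsOnFunctions E ↔ P.RepresentsOnSets E)) ∧
    (∀ P : POVM (SubprobabilityMeasure Ω) H, P.IsSharp → P.RepresentsOnFunctions E →
      MeasurableSet (SubprobabilityMeasure.probabilityMeasures Ω) ∧
      P (SubprobabilityMeasure.probabilityMeasures Ω)ᶜ = 0 ∧
      E.commutant = P.commutant) := by
  refine ⟨?_, fun P _ => POVM.representsOnFunctions_iff.trans POVM.representsOnSets_iff.symm,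
    fun P hP hPE => ⟨SubprobabilityMeasure.measurableSet_probabilityMeasures,
      hPE.apply_compl_probabilityMeasures, hP.commutant_eq hPE⟩⟩
  obtain ⟨P, hP, hPE⟩ := hE.exists_isSharp_representsOnFunctions
  exact ⟨P, ⟨hP, hPE⟩, fun Q hQ => hQ.1.eq_of_representsOnFunctions hP hQ.2 hPE⟩
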